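/- Let $L>0$, let $N=M=S^1=\mathbb{R}/L\mathbb{Z}$, where $M$ carries the flat metric with length element $d\mu=dx$ and $N$ carries a mass form $\nu=m\,dx$ with $m>0$ smooth. Let $\lambda\colon(0,\infty)\to(0,\infty)$ be smooth and put $\varphi(x)=\tfrac12\big(\lambda(x)-x\lambda'(x)\big)$. On the open set of all $(\eta,F)\in C^\infty(N,M\times\mathbb{R})=C^\infty(N,M)\times C^\infty(N,\mathbb{R})$ for which $\eta$ is a diffeomorphism, let $\rho\colon M\to(0,\infty)$ be the density determined by $(\rho\circ\eta)\,\lvert\eta'\rvert=m$, write tangent vectors as $U=(u\circ\eta,f\circ\eta)$, $V=(v\circ\eta,g\circ\eta)$ with smooth functions $u,v,f,g$ on $M$, and consider the weak Riemannian metric $$\langle\!\langle U,V\rangle\!\rangle_{(\eta,F)}=\int_M\big[\lambda(\rho)\,fg+\rho\,uv\big]\,d\mu .$$ (1) This metric has a Levi-Civita connection. If $$x\varphi'(x)+\frac{\varphi(x)^2}{\lambda(x)}\ge 0\quad\text{for all }x>0, \qquad (*)$$ then, with $R(X,Y)Z=\nabla_X\nabla_YZ-\nabla_Y\nabla_XZ-\nabla_{[X,Y]}Z$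 its curvature tensor, the (unnormalized) sectional curvature is nonnegative in every section: $\langle\!\langle R(U,V)V,U\rangle\!\rangle_{(\eta,F)}\ge 0$ for every such $(\eta,F)$ and all tangent vectors $U,V$ at $(\eta,F)$. (2) Suppose that the pressure function $p(x)=x^2\varphi(x)/\lambda(x)^2$ associated with $\lambda$ is polytropic, that is, $p(x)=Ax^\gamma$ for all $x>0$, with constants $A\ne0$ and $\gamma>1$. Then $(*)$ holds if and only if $\gamma\le3$. -/

import Mathlib

open MeasureTheory Set Filter Topology
open scoped ContDiff

namespace BarotropicCircle

/-! The circle of length `L` is `AddCircle L = ℝ / Lℤ`, with the flat metric. Its smooth structure is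
the one for which the quotient map `ℝ → ℝ / Lℤ` is a local diffeomorphism, so smoothness is
tested after lifting to the universal cover `ℝ`. -/

/-- `C^∞(S¹, ℝ)`: the functions on `ℝ / Lℤ` that are smooth as periodic functions on `ℝ`. -/
def SmoothFun (L : ℝ) : Submodule ℝ (AddCircle L → ℝ) where
  carrier := {f | ContDiff ℝ ∞ (fun x : ℝ => f (x : AddCircle L))}
  add_mem' {f g} hf hg := by
    have hf' : ContDiff ℝ ∞ (fun x : ℝ => f (x : AddCircle L)) := hf
    have hg' : ContDiff ℝ ∞ (fun x : ℝ => g (x : AddCircle L)) := hg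
    exact hf'.add hg'
  zero_mem' := (contDiff_const : ContDiff ℝ ∞ (fun _ : ℝ => (0 : ℝ)))
  smul_mem' a f hf := by
    have hf' : ContDiff ℝ ∞ (fun x : ℝ => f (x : AddCircle L)) := hf
    exact contDiff_const.mul hf'

/-- `C^∞(S¹, S¹)`: maps that are covered by a smooth map of the line. -/
def IsSmoothMap {L : ℝ} (η : AddCircle L → AddCircle L) : Prop :=
  ∃ g : ℝ → ℝ, ContDiff ℝ ∞ g ∧ ∀ x : ℝ, η (x : AddCircle L) = ((g x : ℝ) : AddCircle L)

/-- Diffeomorphisms of the circle. -/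
def IsDiffeo {L : ℝ} (η : AddCircle L → AddCircle L) : Prop :=
  IsSmoothMap η ∧ ∃ ζ : AddCircle L → AddCircle L,
    IsSmoothMap ζ ∧ Function.LeftInverse ζ η ∧ Function.RightInverse ζ η

/-- A point `(η, F)` of `C^∞(S¹, S¹ × ℝ)`. -/
structure Config (L : ℝ) where
  η : AddCircle L → AddCircle L
  F : SmoothFun L
  smooth : IsSmoothMap η

/-- The tangent space at any point `(η, F)`. As `T S¹ = S¹ × ℝ`, a vector field along `η` is
a real function; a tangent vector is a pair `(U, A)` of smooth functions on the source circle `N`. -/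
abbrev Tangent (L : ℝ) : Type := SmoothFun L × SmoothFun L

theorem IsSmoothMap.add_fun {L : ℝ} {η : AddCircle L → AddCircle L} (h : IsSmoothMap η)
    (U : SmoothFun L) : IsSmoothMap (fun p => η p + ((U.1 p : ℝ) : AddCircle L)) := by
  obtain ⟨g, hg, hη⟩ := h
  refine ⟨fun x => g x + U.1 (x : AddCircle L), hg.add U.2, fun x => ?_⟩
  simp [hη x]

/-- The exponential chart `X ↦ Exp_c(X)` at `c = (η, F)`. For the flat circle it is
`(U, A) ↦ (η + U mod L, F + A)`. Two such charts differ by translations of the model space. -/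
def Config.exp {L : ℝ} (c : Config L) (X : Tangent L) : Config L where
  η := fun p => c.η p + ((X.1.1 p : ℝ) : AddCircle L)
  F := c.F + X.2
  smooth := c.smooth.add_fun X.1

/-- The Jacobian `|dη|` at `p`: the speed at `t = 0` of the curve `t ↦ η (p + t)`, computed with the
distance `‖·‖` of the circle. -/
noncomputable def jac {L : ℝ} (η : AddCircle L → AddCircle L) (p : AddCircle L) : ℝ :=
  derivWithin (fun t : ℝ => ‖η (p + (t : AddCircle L)) - η p‖) (Ici 0) 0

/-- The Jacobian is the absolute value of the derivative of any lift. -/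
theorem jac_eq_abs_deriv {L : ℝ} (hL : 0 < L) {η : AddCircle L → AddCircle L} {g : ℝ → ℝ}
    (hg : ContDiff ℝ ∞ g) (hη : ∀ x : ℝ, η (x : AddCircle L) = ((g x : ℝ) : AddCircle L))
    (x : ℝ) : jac η (x : AddCircle L) = |deriv g x| := by
  have hd : HasDerivAt g (deriv g x) x :=
    (hg.differentiable (by simp) x).hasDerivAt
  have hd0 : HasDerivAt (fun t : ℝ => g (x + t) - g x) (deriv g x) 0 := by
    have h1 : HasDerivAt g (deriv g x) (x + 0) := by simpa using hd
    exact (h1.comp_const_add x 0).sub_const (g x)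
  have hsmall : ∀ᶠ t : ℝ in 𝓝 0, |g (x + t) - g x| ≤ |L| / 2 := by
    have hc : Tendsto (fun t : ℝ => |g (x + t) - g x|) (𝓝 0) (𝓝 0) := by
      simpa using hd0.continuousAt.tendsto.abs
    exact (hc.eventually (gt_mem_nhds (by positivity : (0 : ℝ) < |L| / 2))).mono fun _ h => h.le
  have hnorm : ∀ t : ℝ, |g (x + t) - g x| ≤ |L| / 2 →
      ‖η ((x : AddCircle L) + (t : AddCircle L)) - η (x : AddCircle L)‖ = |g (x + t) - g x| := by
    intro t ht
    rw [← AddCircle.coe_add, hη, hη, ← AddCircle.coe_sub,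
      (AddCircle.norm_coe_eq_abs_iff L hL.ne').2 ht]
  refine HasDerivWithinAt.derivWithin ?_ (uniqueDiffWithinAt_Ici 0)
  rw [hasDerivWithinAt_iff_tendsto_slope]
  have hs : Tendsto (fun t : ℝ => |slope (fun t : ℝ => g (x + t) - g x) 0 t|)
      (𝓝[Ici 0 \ {0}] 0) (𝓝 |deriv g x|) :=
    ((hasDerivAt_iff_tendsto_slope.1 hd0).mono_left
      (nhdsWithin_mono _ fun t ht => ht.2)).abs
  refine hs.congr' ?_
  filter_upwards [self_mem_nhdsWithin, nhdsWithin_le_nhds hsmall] with t ht hts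
  have ht0 : 0 < t := lt_of_le_of_ne ht.1 (Ne.symm ht.2)
  simp only [slope_def_field, hnorm t hts]
  simp [abs_div, abs_of_pos ht0]

/-- The mass form of `N` is `ν = m dθ` with `m > 0` smooth. For a diffeomorphism `η : N → M` the density
`ρ` on `M` is determined by `Jac(η) · (ρ ∘ η) = m`. -/
noncomputable def density {L : ℝ} (m : SmoothFun L) (η : AddCircle L → AddCircle L)
    (q : AddCircle L) : ℝ :=
  m.1 (Function.invFun η q) / jac η (Function.invFun η q)

/-- The metric `⟪(u∘η, f∘η), (v∘η, g∘η)⟫ = ∫_M [λ(ρ) f g + ρ ⟨u, v⟩] dμ`, where `η` is a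
diffeomorphism and `u = U ∘ η⁻¹`, `f = A ∘ η⁻¹` for a tangent vector `X = (U, A)`. -/
noncomputable def metric {L : ℝ} [Fact (0 < L)] (m : SmoothFun L) (lam : ℝ → ℝ)
    (c : Config L) (X Y : Tangent L) : ℝ :=
  ∫ q : AddCircle L,
    (lam (density m c.η q)
        * (X.2.1 (Function.invFun c.η q) * Y.2.1 (Function.invFun c.η q))
      + density m c.η q
        * (X.1.1 (Function.invFun c.η q) * Y.1.1 (Function.invFun c.η q)))

/-- `V` is the velocity at `t = 0` of the curve `t ↦ W t` in `C^∞(S¹, ℝ)`. A curve of smooth functions is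
smooth when it is jointly smooth in `(t, x)`, and then its velocity is the pointwise one. -/
def HasVelocity {L : ℝ} (W : ℝ → SmoothFun L) (V : SmoothFun L) : Prop :=
  (∃ ε : ℝ, 0 < ε ∧ ContDiffOn ℝ ∞ (fun q : ℝ × ℝ => (W q.1).1 (q.2 : AddCircle L))
      (Ioo (-ε) ε ×ˢ univ)) ∧
    ∀ p : AddCircle L, HasDerivAt (fun t => (W t).1 p) (V.1 p) 0

/-- `D` is the derivative at `c`, in the direction `X`, of the vector field `W` (in a chart). -/
def HasDirDeriv {L : ℝ} (W : Config L → Tangent L) (c : Config L) (X D : Tangent L) : Prop :=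
  HasVelocity (fun t => (W (c.exp (t • X))).1) D.1 ∧
    HasVelocity (fun t => (W (c.exp (t • X))).2) D.2

/-- Christoffel maps: a covariant derivative is written `∇_X Y = D_X Y + Γ_c(X, Y)` in the charts
`Config.exp`. As chart changes are translations, `Γ` does not depend on the chart. -/
abbrev Christoffel (L : ℝ) : Type := Config L → Tangent L →ₗ[ℝ] Tangent L →ₗ[ℝ] Tangent L

/-- `Γ` is the Levi-Civita connection of the metric on the open set of the points `(η, F)` with `η` a
diffeomorphism: it is torsion-free (symmetric) and compatible with the metric,
`D_Z ⟪X, Y⟫ = ⟪Γ(Z, X), Y⟫ + ⟪X, Γ(Z, Y)⟫` for `X`, `Y` constant in a chart. -/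
def IsLeviCivita {L : ℝ} [Fact (0 < L)] (m : SmoothFun L) (lam : ℝ → ℝ)
    (Γ : Christoffel L) : Prop :=
  ∀ c : Config L, IsDiffeo c.η →
    (∀ X Y : Tangent L, Γ c X Y = Γ c Y X) ∧
    ∀ X Y Z : Tangent L,
      HasDerivAt (fun t : ℝ => metric m lam (c.exp (t • Z)) X Y)
        (metric m lam c (Γ c Z X) Y + metric m lam c X (Γ c Z Y)) 0

/-- `R = R(X, Y)Z = ∇_X ∇_Y Z - ∇_Y ∇_X Z - ∇_[X,Y] Z` at `c`, for `X`, `Y`, `Z` constant in a chart (so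
that `[X, Y] = 0`); that is `R = (D_X Γ)(Y, Z) - (D_Y Γ)(X, Z) + Γ(X, Γ(Y, Z)) - Γ(Y, Γ(X, Z))`. -/
def IsCurvature {L : ℝ} (Γ : Christoffel L) (c : Config L) (X Y Z R : Tangent L) : Prop :=
  ∃ D₁ D₂ : Tangent L,
    HasDirDeriv (fun b => Γ b Y Z) c X D₁ ∧ HasDirDeriv (fun b => Γ b X Z) c Y D₂ ∧
      R = D₁ - D₂ + Γ c X (Γ c Y Z) - Γ c Y (Γ c X Z)

/-- `φ(x) = (λ(x) - x λ'(x)) / 2`. -/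
noncomputable def phi (lam : ℝ → ℝ) (x : ℝ) : ℝ := (lam x - x * deriv lam x) / 2

/-- `x φ'(x) + φ(x)² / λ(x) ≥ 0` on the domain `(0, ∞)` of `λ`. -/
def CurvatureCondition (lam : ℝ → ℝ) : Prop :=
  ∀ x : ℝ, 0 < x → 0 ≤ x * deriv (phi lam) x + phi lam x ^ 2 / lam x

/-- The pressure function `p(x) = x² φ(x) / λ(x)²` of the barotropic fluid given by `λ`. -/
noncomputable def pressure (lam : ℝ → ℝ) (x : ℝ) : ℝ := x ^ 2 * phi lam x / lam x ^ 2

end BarotropicCircle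

/-! Everything is pulled back to the source circle. With `J = |η'|` the metric becomes `∫ (κ A B + m
U V)`, where `κ = J λ(m / J)` and the weight `m` does not depend on the configuration
(`IsLift.metric_eq` is not needed: this is `metric_eq`). Along a chart line `J` is affine, `J + t σ
U'` with `σ = ±1` the orientation, and `dκ/dJ = 2 φ(m / J)`. So all the geometry is carried by `P =
σ φ(ρ)` and its derivative `Q`.

The metric is weak, so existence of a connection is not automatic. The Koszul formula is solved
explicitly by `christoffel`, compatibility holding up to an exact derivative, which integrates to
zero (`integral_christoffel_add`). Nondegeneracy makes this solution the only one
(`IsLeviCivita.eq_leviCivita`).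

The core is `integral_curvature`: modulo an exact derivative, the curvature integrand for `(U, A)`,
`(V, B)` is `(P² / κ - Q) (U' B - V' A)² + (P² / m) (A' B - A B')²`. The second coefficient is
nonnegative, and the first equals `(ρ φ'(ρ) + φ(ρ)² / λ(ρ)) / J`, which is where the curvature
condition enters.

For a polytropic pressure, `(x / λ)' = 2 p / x²` integrates to `x / λ = a x^(γ-1) + C`. Positivity
of `λ` forces `a > 0` and `C ≥ 0`, and the condition becomes the sign of an affine function of
`x^(γ-1)` with slope `a (3 - γ) / 2`. -/

namespace BarotropicCircle

/-! ### The ring of smooth functions on the circle -/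

namespace SmoothFun

variable {L : ℝ}

theorem contDiff (f : SmoothFun L) : ContDiff ℝ ∞ (fun x : ℝ => f.1 (x : AddCircle L)) := f.2

instance : Mul (SmoothFun L) := ⟨fun f g => ⟨f.1 * g.1, (SmoothFun.contDiff f).mul (SmoothFun.contDiff g)⟩⟩

instance : One (SmoothFun L) :=
  ⟨⟨1, (contDiff_const : ContDiff ℝ ∞ (fun _ : ℝ => (1 : ℝ)))⟩⟩

@[simp] theorem coe_mul (f g : SmoothFun L) (p : AddCircle L) : (f * g).1 p = f.1 p * g.1 p := rfl

@[simp] theorem coe_one (p : AddCircle L) : (1 : SmoothFun L).1 p = 1 := rfl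

@[simp] theorem coe_add (f g : SmoothFun L) (p : AddCircle L) : (f + g).1 p = f.1 p + g.1 p := rfl

@[simp] theorem coe_sub (f g : SmoothFun L) (p : AddCircle L) : (f - g).1 p = f.1 p - g.1 p := rfl

@[simp] theorem coe_neg (f : SmoothFun L) (p : AddCircle L) : (-f).1 p = -f.1 p := rfl

@[simp] theorem coe_zero (p : AddCircle L) : (0 : SmoothFun L).1 p = 0 := rfl

@[simp] theorem coe_smul (a : ℝ) (f : SmoothFun L) (p : AddCircle L) :
    (a • f).1 p = a * f.1 p := rfl

@[ext] theorem ext {f g : SmoothFun L} (h : ∀ p, f.1 p = g.1 p) : f = g :=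
  Subtype.ext (funext h)

/-- With this structure, integrand identities become commutative algebra with a derivation `D`,
within reach of `ring` and `linear_combination`. -/
instance : CommRing (SmoothFun L) :=
  { (inferInstance : AddCommGroup (SmoothFun L)) with
    mul := (· * ·)
    one := 1
    left_distrib := fun f g h => by ext p; simp [mul_add]
    right_distrib := fun f g h => by ext p; simp [add_mul]
    zero_mul := fun f => by ext p; simp
    mul_zero := fun f => by ext p; simp
    mul_assoc := fun f g h => by ext p; simp [mul_assoc]
    one_mul := fun f => by ext p; simp
    mul_one := fun f => by ext p; simp
    mul_comm := fun f g => by ext p; simp [mul_comm] }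

instance : Algebra ℝ (SmoothFun L) :=
  Algebra.ofModule (fun a f g => by ext p; simp [mul_assoc])
    (fun a f g => by ext p; simp [mul_left_comm])

open Classical in
/-- The smooth function given by `f`, and `0` if `f` is not smooth. -/
noncomputable def ofFun (f : AddCircle L → ℝ) : SmoothFun L :=
  if h : f ∈ SmoothFun L then ⟨f, h⟩ else 0

theorem ofFun_apply {f : AddCircle L → ℝ} (h : ContDiff ℝ ∞ (fun x : ℝ => f (x : AddCircle L)))
    (p : AddCircle L) : (ofFun f).1 p = f p := by
  have h' : f ∈ SmoothFun L := h
  simp [ofFun, h']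

/-- The composition of a smooth function on `(0, ∞)` with a positive smooth function. -/
noncomputable def comp (F : ℝ → ℝ) (f : SmoothFun L) : SmoothFun L := ofFun (fun p => F (f.1 p))

theorem comp_apply {F : ℝ → ℝ} (hF : ContDiffOn ℝ ∞ F (Ioi 0)) {f : SmoothFun L}
    (hf : ∀ p, 0 < f.1 p) (p : AddCircle L) : (comp F f).1 p = F (f.1 p) :=
  ofFun_apply (hF.comp_contDiff (SmoothFun.contDiff f) fun _ => hf _) p

/-- The derivative of a smooth function on the circle. -/
noncomputable def D : SmoothFun L →ₗ[ℝ] SmoothFun L where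
  -- Differentiating along translations of `p` avoids choosing a representative in `ℝ`.
  toFun f := ⟨fun p => deriv (fun t : ℝ => f.1 (p + (t : AddCircle L))) 0, by
    have h : (fun x : ℝ => deriv (fun t : ℝ => f.1 ((x : AddCircle L) + (t : AddCircle L))) 0)
        = deriv (fun x : ℝ => f.1 (x : AddCircle L)) := by
      funext x
      have := deriv_comp_const_add (f := fun x : ℝ => f.1 (x : AddCircle L)) x 0
      simpa using this
    change ContDiff ℝ ∞ (fun x : ℝ => deriv (fun t : ℝ => f.1 ((x : AddCircle L) + t)) 0)
    rw [h]
    exact ((contDiff_infty_iff_deriv).1 (SmoothFun.contDiff f)).2⟩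
  map_add' f g := by
    ext p
    induction p using QuotientAddGroup.induction_on with | _ x =>
    have hs (f : SmoothFun L) :
        DifferentiableAt ℝ (fun t : ℝ => f.1 ((x : AddCircle L) + (t : AddCircle L))) 0 := by
      have h : ContDiff ℝ ∞ (fun t : ℝ => f.1 ((x + t : ℝ) : AddCircle L)) :=
        (SmoothFun.contDiff f).comp (contDiff_const.add contDiff_id)
      simpa using (h.differentiable (by simp)) 0
    exact deriv_add (hs f) (hs g)
  map_smul' a f := by
    ext p
    exact deriv_const_mul_field a

theorem D_apply (f : SmoothFun L) (x : ℝ) :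
    (D f).1 (x : AddCircle L) = deriv (fun y : ℝ => f.1 (y : AddCircle L)) x := by
  have := deriv_comp_const_add (f := fun x : ℝ => f.1 (x : AddCircle L)) x 0
  simpa [D] using this

theorem hasDerivAt (f : SmoothFun L) (x : ℝ) :
    HasDerivAt (fun y : ℝ => f.1 (y : AddCircle L)) ((D f).1 (x : AddCircle L)) x := by
  rw [D_apply]
  exact ((SmoothFun.contDiff f).differentiable (by simp) x).hasDerivAt

@[simp] theorem D_mul (f g : SmoothFun L) : D (f * g) = D f * g + f * D g := by
  ext p
  induction p using QuotientAddGroup.induction_on with | _ x =>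
  have h1 := (hasDerivAt (f * g) x).unique ((hasDerivAt f x).mul (hasDerivAt g x))
  simpa using h1

theorem continuous (f : SmoothFun L) : Continuous f.1 :=
  continuous_coinduced_dom.2 (SmoothFun.contDiff f).continuous

theorem lift_periodic (f : SmoothFun L) :
    Function.Periodic (fun x : ℝ => f.1 (x : AddCircle L)) L := fun x => by simp

/-! ### Integration -/

variable [Fact (0 < L)]

theorem integrable (f : SmoothFun L) : Integrable f.1 :=
  (SmoothFun.continuous f).integrable_of_hasCompactSupport (HasCompactSupport.of_compactSpace _)

/-- The integral over the circle. -/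
noncomputable def integral : SmoothFun L →ₗ[ℝ] ℝ where
  toFun f := ∫ p, f.1 p
  map_add' f g := integral_add (SmoothFun.integrable f) (SmoothFun.integrable g)
  map_smul' a f := integral_const_mul a f.1

theorem integral_apply (f : SmoothFun L) : integral f = ∫ p, f.1 p := rfl

theorem integral_eq (f : SmoothFun L) :
    integral f = ∫ x in (0 : ℝ)..L, f.1 (x : AddCircle L) := by
  have := AddCircle.intervalIntegral_preimage L 0 f.1
  rw [zero_add] at this
  exact this.symm

-- By periodicity the boundary terms cancel. Integrations by parts below amount to discarding such a
-- term.
@[simp] theorem integral_D (f : SmoothFun L) : integral (D f) = 0 := by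
  rw [integral_eq, intervalIntegral.integral_eq_sub_of_hasDerivAt
    (fun x _ => hasDerivAt f x) ((SmoothFun.contDiff (D f)).continuous.intervalIntegrable _ _)]
  simpa using sub_eq_zero.2 ((SmoothFun.lift_periodic f) 0)

theorem integral_nonneg {f : SmoothFun L} (h : ∀ p, 0 ≤ f.1 p) : 0 ≤ integral f :=
  MeasureTheory.integral_nonneg h

theorem eq_zero_of_integral_eq_zero {f : SmoothFun L} (h : ∀ p, 0 ≤ f.1 p)
    (h0 : integral f = 0) : f = 0 := by
  have h1 := (integral_eq_zero_iff_of_nonneg (μ := volume) h (SmoothFun.integrable f)).1 h0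
  have h2 : f.1 = 0 := ((SmoothFun.continuous f).ae_eq_iff_eq volume continuous_const).1 h1
  exact Subtype.ext h2

theorem exists_pos_le {f : SmoothFun L} (hf : ∀ p, 0 < f.1 p) :
    ∃ δ, 0 < δ ∧ ∀ p, δ ≤ f.1 p := by
  obtain ⟨p, -, hp⟩ := isCompact_univ.exists_isMinOn univ_nonempty
    (SmoothFun.continuous f).continuousOn
  exact ⟨f.1 p, hf p, fun q => hp (mem_univ q)⟩

end SmoothFun

/-! ### Velocities of curves of smooth functions -/

namespace HasVelocity

open SmoothFun

variable {L : ℝ} {W W' : ℝ → SmoothFun L} {V V' : SmoothFun L}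

theorem congr (h : HasVelocity W V) (e : ∀ᶠ t in 𝓝 0, W' t = W t) : HasVelocity W' V := by
  obtain ⟨⟨ε, hε, hs⟩, hd⟩ := h
  refine ⟨?_, fun p => (hd p).congr_of_eventuallyEq (e.mono fun t ht => congrArg (fun f => f.1 p) ht)⟩
  obtain ⟨δ, hδ, hb⟩ := Metric.eventually_nhds_iff.1 e
  refine ⟨min ε δ, lt_min hε hδ, (hs.mono ?_).congr ?_⟩
  · rintro ⟨t, x⟩ ⟨⟨h1, h2⟩, -⟩
    exact ⟨⟨by linarith [min_le_left ε δ], by linarith [min_le_left ε δ]⟩, mem_univ _⟩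
  · rintro ⟨t, x⟩ ⟨⟨h1, h2⟩, -⟩
    have : dist t 0 < δ := by
      rw [Real.dist_eq, sub_zero, abs_lt]
      exact ⟨by linarith [min_le_right ε δ], by linarith [min_le_right ε δ]⟩
    simp [hb this]

theorem congr_velocity (h : HasVelocity W V) (e : V = V') : HasVelocity W V' := e ▸ h

theorem const (f : SmoothFun L) : HasVelocity (fun _ => f) 0 :=
  ⟨⟨1, one_pos, ((SmoothFun.contDiff f).comp contDiff_snd).contDiffOn⟩, fun _ => hasDerivAt_const _ _⟩

theorem smul_id (f : SmoothFun L) : HasVelocity (fun t => t • f) f := by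
  refine ⟨⟨1, one_pos, (contDiff_fst.mul ((SmoothFun.contDiff f).comp contDiff_snd)).contDiffOn⟩, fun p => ?_⟩
  simpa using (hasDerivAt_id (0 : ℝ)).mul_const (f.1 p)

theorem common (h : HasVelocity W V) (h' : HasVelocity W' V') : ∃ ε : ℝ, 0 < ε ∧
    ContDiffOn ℝ ∞ (fun q : ℝ × ℝ => (W q.1).1 (q.2 : AddCircle L)) (Ioo (-ε) ε ×ˢ univ) ∧
    ContDiffOn ℝ ∞ (fun q : ℝ × ℝ => (W' q.1).1 (q.2 : AddCircle L)) (Ioo (-ε) ε ×ˢ univ) := by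
  obtain ⟨⟨ε, hε, hs⟩, -⟩ := h
  obtain ⟨⟨δ, hδ, hs'⟩, -⟩ := h'
  refine ⟨min ε δ, lt_min hε hδ, hs.mono ?_, hs'.mono ?_⟩ <;>
  · refine prod_mono (Ioo_subset_Ioo ?_ ?_) subset_rfl <;> simp

theorem add (h : HasVelocity W V) (h' : HasVelocity W' V') :
    HasVelocity (fun t => W t + W' t) (V + V') := by
  obtain ⟨ε, hε, hs, hs'⟩ := h.common h'
  exact ⟨⟨ε, hε, hs.add hs'⟩, fun p => (h.2 p).add (h'.2 p)⟩

theorem mul (h : HasVelocity W V) (h' : HasVelocity W' V') :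
    HasVelocity (fun t => W t * W' t) (V * W' 0 + W 0 * V') := by
  obtain ⟨ε, hε, hs, hs'⟩ := h.common h'
  exact ⟨⟨ε, hε, hs.mul hs'⟩, fun p => (h.2 p).mul (h'.2 p)⟩

theorem mul_const (h : HasVelocity W V) (f : SmoothFun L) :
    HasVelocity (fun t => W t * f) (V * f) := by
  simpa using h.mul (const f)

theorem const_mul (h : HasVelocity W V) (f : SmoothFun L) :
    HasVelocity (fun t => f * W t) (f * V) := by
  simpa using (const f).mul h

theorem const_smul (h : HasVelocity W V) (a : ℝ) :
    HasVelocity (fun t => a • W t) (a • V) := by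
  obtain ⟨ε, hε, hs⟩ := h.1
  exact ⟨⟨ε, hε, contDiffOn_const.mul hs⟩, fun p => (h.2 p).const_mul a⟩

/-- `F` is controlled only on `(0, ∞)`, so positivity is needed at all points of the circle
simultaneously, for `t` near `0`. -/
theorem comp {F : ℝ → ℝ} (hF : ContDiffOn ℝ ∞ F (Ioi 0)) (h : HasVelocity W V)
    (hpos : ∀ᶠ t in 𝓝 0, ∀ p, 0 < (W t).1 p) :
    HasVelocity (fun t => SmoothFun.comp F (W t)) (SmoothFun.comp (deriv F) (W 0) * V) := by
  obtain ⟨ε, hε, hs⟩ := h.1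
  obtain ⟨δ, hδ, hb⟩ := Metric.eventually_nhds_iff.1 hpos
  have hF' : ContDiffOn ℝ ∞ (deriv F) (Ioi 0) :=
    ((contDiffOn_infty_iff_deriv_of_isOpen isOpen_Ioi).1 hF).2
  have hp (t : ℝ) (ht : t ∈ Ioo (-min ε δ) (min ε δ)) : ∀ p, 0 < (W t).1 p := by
    apply hb
    rw [Real.dist_eq, sub_zero, abs_lt]
    exact ⟨by linarith [min_le_right ε δ, ht.1], by linarith [min_le_right ε δ, ht.2]⟩
  refine ⟨⟨min ε δ, lt_min hε hδ, ?_⟩, fun p => ?_⟩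
  · have h1 : ContDiffOn ℝ ∞ (fun q : ℝ × ℝ => F ((W q.1).1 (q.2 : AddCircle L)))
        (Ioo (-min ε δ) (min ε δ) ×ˢ univ) :=
      hF.comp (hs.mono (prod_mono (Ioo_subset_Ioo (by simp) (by simp)) subset_rfl))
        fun q hq => hp _ hq.1 _
    exact h1.congr fun q hq => comp_apply hF (hp _ hq.1) _
  · have h0 := hpos.self_of_nhds
    have h1 : HasDerivAt F (deriv F ((W 0).1 p)) ((W 0).1 p) :=
      ((hF.differentiableOn (by simp)).differentiableAt (Ioi_mem_nhds (h0 p))).hasDerivAt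
    rw [coe_mul, comp_apply hF' h0]
    exact (h1.comp 0 (h.2 p)).congr_of_eventuallyEq (hpos.mono fun t ht => comp_apply hF ht p)

/-- Mixed partial derivatives commute; this is what joint smoothness in `HasVelocity` is for. -/
theorem D (h : HasVelocity W V) : HasVelocity (fun t => D (W t)) (D V) := by
  obtain ⟨⟨ε, hε, hs⟩, hd⟩ := h
  set G : ℝ × ℝ → ℝ := fun q => (W q.1).1 (q.2 : AddCircle L) with hG
  have hO : IsOpen (Ioo (-ε) ε ×ˢ (univ : Set ℝ)) := isOpen_Ioo.prod isOpen_univ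
  have hG' : ContDiffOn ℝ ∞ (fderiv ℝ G) (Ioo (-ε) ε ×ˢ univ) :=
    hs.fderiv_of_isOpen hO (by simp)
  have hfd (q : ℝ × ℝ) (hq : q ∈ Ioo (-ε) ε ×ˢ (univ : Set ℝ)) : HasFDerivAt G (fderiv ℝ G q) q :=
    ((hs.differentiableOn (by simp)).differentiableAt (hO.mem_nhds hq)).hasFDerivAt
  have hfd' (q : ℝ × ℝ) (hq : q ∈ Ioo (-ε) ε ×ˢ (univ : Set ℝ)) :
      HasFDerivAt (fderiv ℝ G) (fderiv ℝ (fderiv ℝ G) q) q :=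
    ((hG'.differentiableOn (by simp)).differentiableAt (hO.mem_nhds hq)).hasFDerivAt
  have hx (t x : ℝ) : HasDerivAt (fun y : ℝ => (t, y)) ((0 : ℝ), (1 : ℝ)) x :=
    (hasDerivAt_const x t).prodMk (hasDerivAt_id x)
  have ht (t x : ℝ) : HasDerivAt (fun s : ℝ => (s, x)) ((1 : ℝ), (0 : ℝ)) t :=
    (hasDerivAt_id t).prodMk (hasDerivAt_const t x)
  have hD (q : ℝ × ℝ) (hq : q ∈ Ioo (-ε) ε ×ˢ (univ : Set ℝ)) :
      (SmoothFun.D (W q.1)).1 (q.2 : AddCircle L) = fderiv ℝ G q (0, 1) :=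
    (hasDerivAt (W q.1) q.2).unique
        (HasFDerivAt.comp_hasDerivAt (f := fun y => (q.1, y)) q.2 (hfd q hq) (hx q.1 q.2))
  have h0 (x : ℝ) : ((0 : ℝ), x) ∈ Ioo (-ε) ε ×ˢ (univ : Set ℝ) := ⟨⟨by linarith, hε⟩, mem_univ _⟩
  have hV (x : ℝ) : V.1 (x : AddCircle L) = fderiv ℝ G (0, x) (1, 0) :=
    (hd (x : AddCircle L)).unique
      (HasFDerivAt.comp_hasDerivAt (f := fun s => (s, x)) 0 (hfd _ (h0 x)) (ht 0 x))
  refine ⟨⟨ε, hε, ?_⟩, fun p => ?_⟩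
  · exact (hG'.clm_apply contDiffOn_const).congr hD
  · induction p using QuotientAddGroup.induction_on with | _ x =>
    have h1 : HasDerivAt (fun t : ℝ => fderiv ℝ G (t, x) (0, 1))
        (fderiv ℝ (fderiv ℝ G) (0, x) (1, 0) (0, 1)) 0 := by
      have h2 : HasDerivAt (fun t : ℝ => fderiv ℝ G (t, x))
          (fderiv ℝ (fderiv ℝ G) (0, x) (1, 0)) 0 :=
        (hfd' _ (h0 x)).comp_hasDerivAt 0 (ht 0 x)
      simpa using h2.clm_apply (hasDerivAt_const (0 : ℝ) ((0 : ℝ), (1 : ℝ)))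
    have h2 : HasDerivAt (fun y : ℝ => fderiv ℝ G (0, y) (1, 0))
        (fderiv ℝ (fderiv ℝ G) (0, x) (0, 1) (1, 0)) x := by
      have h2 : HasDerivAt (fun y : ℝ => fderiv ℝ G (0, y))
          (fderiv ℝ (fderiv ℝ G) (0, x) (0, 1)) x :=
        (hfd' _ (h0 x)).comp_hasDerivAt x (hx 0 x)
      simpa using h2.clm_apply (hasDerivAt_const x ((1 : ℝ), (0 : ℝ)))
    have hsymm : IsSymmSndFDerivAt ℝ G (0, x) :=
      (hs.contDiffAt (hO.mem_nhds (h0 x))).isSymmSndFDerivAt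
        (by simpa using WithTop.coe_le_coe.2 (le_top : (2 : ℕ∞) ≤ ⊤))
    have h3 : (SmoothFun.D V).1 (x : AddCircle L)
        = fderiv ℝ (fderiv ℝ G) (0, x) (1, 0) (0, 1) := by
      rw [hsymm.eq]
      refine (hasDerivAt V x).unique ?_
      simpa only [hV] using h2
    change HasDerivAt _ ((SmoothFun.D V).1 (x : AddCircle L)) 0
    rw [h3]
    refine h1.congr_of_eventuallyEq ?_
    filter_upwards [Ioo_mem_nhds (neg_lt_zero.2 hε) hε] with t ht
    exact hD (t, x) ⟨ht, mem_univ _⟩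

theorem integral [Fact (0 < L)] (h : HasVelocity W V) :
    HasDerivAt (fun t => integral (W t)) (integral V) 0 := by
  obtain ⟨⟨ε, hε, hs⟩, hd⟩ := h
  set G : ℝ × ℝ → ℝ := fun q => (W q.1).1 (q.2 : AddCircle L) with hG
  have hO : IsOpen (Ioo (-ε) ε ×ˢ (univ : Set ℝ)) := isOpen_Ioo.prod isOpen_univ
  have hG' : ContDiffOn ℝ ∞ (fderiv ℝ G) (Ioo (-ε) ε ×ˢ univ) :=
    hs.fderiv_of_isOpen hO (by simp)
  have ht (t x : ℝ) : HasDerivAt (fun s : ℝ => (s, x)) ((1 : ℝ), (0 : ℝ)) t :=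
    (hasDerivAt_id t).prodMk (hasDerivAt_const t x)
  have hder (q : ℝ × ℝ) (hq : q ∈ Ioo (-ε) ε ×ˢ (univ : Set ℝ)) :
      HasDerivAt (fun s => (W s).1 (q.2 : AddCircle L)) (fderiv ℝ G q (1, 0)) q.1 :=
    HasFDerivAt.comp_hasDerivAt (f := fun s => (s, q.2)) q.1
      ((hs.differentiableOn (by simp)).differentiableAt (hO.mem_nhds hq)).hasFDerivAt
      (ht q.1 q.2)
  -- Halving `ε` gives a compact box, on which the time derivative is bounded; the bound justifies
  -- differentiating under the integral.
  have hsub : Icc (-(ε / 2)) (ε / 2) ×ˢ uIcc 0 L ⊆ Ioo (-ε) ε ×ˢ (univ : Set ℝ) :=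
    prod_mono (fun t ht => ⟨by linarith [ht.1], by linarith [ht.2]⟩) (subset_univ _)
  obtain ⟨C, hC⟩ := (isCompact_Icc.prod isCompact_uIcc).exists_bound_of_continuousOn
    (((hG'.continuousOn.mono hsub).clm_apply
      (continuousOn_const (c := ((1 : ℝ), (0 : ℝ))))))
  have h0 (x : ℝ) : ((0 : ℝ), x) ∈ Ioo (-ε) ε ×ˢ (univ : Set ℝ) := ⟨⟨by linarith, hε⟩, mem_univ _⟩
  have hV (x : ℝ) : V.1 (x : AddCircle L) = fderiv ℝ G (0, x) (1, 0) :=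
    (hd (x : AddCircle L)).unique (hder _ (h0 x))
  simp only [SmoothFun.integral_eq]
  have key := intervalIntegral.hasDerivAt_integral_of_dominated_loc_of_deriv_le
    (μ := volume) (a := 0) (b := L)
    (F := fun t x => (W t).1 (x : AddCircle L)) (F' := fun t x => fderiv ℝ G (t, x) (1, 0))
    (x₀ := 0) (s := Icc (-(ε / 2)) (ε / 2)) (bound := fun _ => C)
    (Icc_mem_nhds (by linarith) (by linarith))
    (Eventually.of_forall fun t => (SmoothFun.contDiff (W t)).continuous.aestronglyMeasurable)
    ((SmoothFun.contDiff (W 0)).continuous.intervalIntegrable _ _)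
    (by simp only [← hV]; exact (SmoothFun.contDiff V).continuous.aestronglyMeasurable)
    (Eventually.of_forall fun x hx t ht => hC (t, x) ⟨ht, uIoc_subset_uIcc hx⟩)
    intervalIntegrable_const
    (Eventually.of_forall fun x hx t ht => hder (t, x) (hsub ⟨ht, uIoc_subset_uIcc hx⟩))
  simpa only [hV] using key.2

end HasVelocity

open SmoothFun

/-! ### Diffeomorphisms of the circle and their lifts -/

variable {L : ℝ}

theorem IsSmoothMap.continuous {η : AddCircle L → AddCircle L} (h : IsSmoothMap η) :
    Continuous η := by
  obtain ⟨g, hg, hη⟩ := h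
  refine continuous_coinduced_dom.2 ?_
  have : η ∘ ((↑) : ℝ → AddCircle L) = fun x => ((g x : ℝ) : AddCircle L) := funext hη
  change Continuous (η ∘ ((↑) : ℝ → AddCircle L))
  rw [this]
  exact (AddCircle.continuous_mk' L).comp hg.continuous

/-- A continuous function on the line that lifts a constant on the circle is constant. -/
theorem exists_eq_add_of_coe_eq (hL : L ≠ 0) {f₁ f₂ : ℝ → ℝ} (h₁ : Continuous f₁)
    (h₂ : Continuous f₂) (h : ∀ x, (f₁ x : AddCircle L) = (f₂ x : AddCircle L)) :
    ∃ n : ℤ, ∀ x, f₁ x = f₂ x + n * L := by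
  have h' (x : ℝ) : ∃ n : ℤ, f₁ x = f₂ x + n * L := by
    have h3 : ((f₁ x - f₂ x : ℝ) : AddCircle L) = 0 := by
      rw [AddCircle.coe_sub, h x, sub_self]
    obtain ⟨n, hn⟩ := (AddCircle.coe_eq_zero_iff L).1 h3
    refine ⟨n, ?_⟩
    rw [← zsmul_eq_mul, hn]
    ring
  choose n hn using h'
  have hc : Continuous n := by
    rw [Int.isClosedEmbedding_coe_real.isEmbedding.continuous_iff]
    have : ((↑) : ℤ → ℝ) ∘ n = fun x => (f₁ x - f₂ x) / L := by
      funext x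
      simp [hn x, hL]
    rw [this]
    exact (h₁.sub h₂).div_const L
  exact ⟨n 0, fun x => by rw [hn x, PreconnectedSpace.constant inferInstance hc (x := x) (y := 0)]⟩

/-- `g` lifts `η` to a diffeomorphism of the line, which preserves the orientation if `σ = 1` and
reverses it if `σ = -1`. -/
structure IsLift (η : AddCircle L → AddCircle L) (σ : ℝ) (g : ℝ → ℝ) : Prop where
  contDiff : ContDiff ℝ ∞ g
  coe_apply : ∀ x : ℝ, η (x : AddCircle L) = ((g x : ℝ) : AddCircle L)
  sign : σ = 1 ∨ σ = -1
  deriv_pos : ∀ x, 0 < σ * deriv g x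
  add_period : ∀ x, g (x + L) = g x + σ * L

/-- If `g` and `k` lift the map and its inverse, `k ∘ g` is the identity up to a constant. Hence
`g'` never vanishes and the degrees satisfy `d * e = 1`, so that `d = ±1`. -/
theorem IsDiffeo.exists_isLift (hL : 0 < L) {η : AddCircle L → AddCircle L} (h : IsDiffeo η) :
    ∃ σ g, IsLift η σ g := by
  obtain ⟨⟨g, hg, hη⟩, ζ, ⟨k, hk, hζ⟩, hl, hr⟩ := h
  have hg' := hg.continuous
  have hk' := hk.continuous
  obtain ⟨n, hn⟩ := exists_eq_add_of_coe_eq hL.ne' (f₁ := fun x => k (g x)) (f₂ := id)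
    (hk'.comp hg') continuous_id fun x => by rw [← hζ, ← hη, hl]; rfl
  obtain ⟨d, hd⟩ := exists_eq_add_of_coe_eq hL.ne' (f₁ := fun x => g (x + L)) (f₂ := g)
    (hg'.comp (continuous_add_const L)) hg' fun x => by rw [← hη, ← hη]; simp
  obtain ⟨e, he⟩ := exists_eq_add_of_coe_eq hL.ne' (f₁ := fun x => k (x + L)) (f₂ := k)
    (hk'.comp (continuous_add_const L)) hk' fun x => by rw [← hζ, ← hζ]; simp
  have hne (x : ℝ) : deriv g x ≠ 0 := by
    intro h0
    have h1 : HasDerivAt (fun x => k (g x)) (deriv k (g x) * deriv g x) x :=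
      HasDerivAt.comp x (hk.differentiable (by simp) _).hasDerivAt
        (hg.differentiable (by simp) x).hasDerivAt
    have h2 : HasDerivAt (fun x => k (g x)) 1 x := by
      simp only [hn]
      exact (hasDerivAt_id x).add_const _
    have := h1.unique h2
    simp [h0] at this
  have he' (j : ℤ) : ∀ x, k (x + j * L) = k x + j * (e * L) := by
    have hp : Function.Periodic (fun x => k x - x * e) L := fun x => by
      have := he x
      dsimp only at this ⊢
      rw [this]
      ring
    intro x
    have := hp.int_mul j x
    linear_combination this
  have hde : d * e = 1 := by
    have h1 : k (g (0 + L)) = k (g 0) + d * (e * L) := by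
      rw [← he' d, ← hd 0]
    have h2 := hn (0 + L)
    have h3 := hn 0
    simp only [id] at h2 h3
    have : ((d * e : ℤ) : ℝ) * L = 1 * L := by
      push_cast
      linear_combination -h1 + h2 - h3
    exact_mod_cast mul_right_cancel₀ hL.ne' this
  have hd1 : d = 1 ∨ d = -1 := Int.isUnit_iff.1 (IsUnit.of_mul_eq_one e hde)
  -- The mean slope over a period is `d`, so `g'` has the sign of `d` somewhere, hence everywhere
  -- since it has no zero.
  have hmvt : ∃ x, deriv g x = d := by
    obtain ⟨x, -, hx⟩ := exists_deriv_eq_slope g hL hg'.continuousOn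
      (hg.differentiable (by simp)).differentiableOn
    refine ⟨x, ?_⟩
    have := hd 0
    rw [zero_add] at this
    rw [hx, this, sub_zero, add_sub_cancel_left, mul_div_cancel_right₀ _ hL.ne']
  have hcont : Continuous (deriv g) := hg.continuous_deriv (by simp)
  obtain ⟨x₀, hx₀⟩ := hmvt
  have hd2 : (d : ℝ) * d = 1 := by rcases hd1 with rfl | rfl <;> norm_num
  refine ⟨d, g, hg, hη, ?_, fun x => ?_, hd⟩
  · rcases hd1 with rfl | rfl <;> simp
  · by_contra hx
    obtain ⟨y, hy⟩ := mem_range_of_exists_le_of_exists_ge (c := (0 : ℝ))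
      (continuous_const.mul hcont : Continuous fun x => (d : ℝ) * deriv g x)
      ⟨x, not_lt.1 hx⟩ ⟨x₀, by simp [hx₀, hd2]⟩
    rcases mul_eq_zero.1 hy with h0 | h0
    · simp [h0] at hd2
    · exact hne y h0

namespace IsLift

variable {η : AddCircle L → AddCircle L} {σ : ℝ} {g : ℝ → ℝ}

theorem sign_mul_self (h : IsLift η σ g) : σ * σ = 1 := by
  rcases h.sign with rfl | rfl <;> norm_num

/-- `σ g` is an increasing bijection of the line with smooth inverse, and the inverse descends to
the circle. `IsLeviCivita` says nothing away from diffeomorphisms, so this is needed at nearby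
configurations too. -/
theorem isDiffeo (hL : 0 < L) (h : IsLift η σ g) : IsDiffeo η := by
  have hσ := h.sign_mul_self
  have hkd (x : ℝ) : HasDerivAt (fun x => σ * g x) (σ * deriv g x) x :=
    (h.contDiff.differentiable (by simp) x).hasDerivAt.const_mul σ
  have hmono : StrictMono (fun x => σ * g x) :=
    strictMono_of_deriv_pos fun x => by rw [(hkd x).deriv]; exact h.deriv_pos x
  have hper : Function.Periodic (fun x => σ * g x - x) L := fun x => by
    dsimp only
    rw [h.add_period]
    linear_combination L * hσ
  have hint (j : ℤ) : σ * g (j * L) = σ * g 0 + j * L := by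
    have := hper.int_mul j 0
    rw [zero_add] at this
    linear_combination this
  have hsurj : Function.Surjective (fun x => σ * g x) := by
    intro y
    -- At `j * L` the function equals `σ * g 0 + j * L`, so rounding `(y - σ * g 0) / L` down and up
    -- brackets `y`.
    refine mem_range_of_exists_le_of_exists_ge (continuous_const.mul h.contDiff.continuous)
      ⟨(⌊(y - σ * g 0) / L⌋ : ℤ) * L, ?_⟩ ⟨(⌈(y - σ * g 0) / L⌉ : ℤ) * L, ?_⟩
    · have := (le_div_iff₀ hL).1 (Int.floor_le ((y - σ * g 0) / L))
      rw [hint]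
      linarith
    · have := (div_le_iff₀ hL).1 (Int.le_ceil ((y - σ * g 0) / L))
      rw [hint]
      linarith
  let e : ℝ ≃ₜ ℝ := (hmono.orderIsoOfSurjective _ hsurj).toHomeomorph
  have he (x : ℝ) : e x = σ * g x := rfl
  have hes : ContDiff ℝ ∞ e.symm :=
    e.contDiff_symm_deriv (fun x => (h.deriv_pos x).ne') hkd (contDiff_const.mul h.contDiff)
  have hl (x : ℝ) : e.symm (σ * g x) = x := e.symm_apply_apply x
  have hr (y : ℝ) : g (e.symm (σ * y)) = y := by
    have h1 : σ * g (e.symm (σ * y)) = σ * y := e.apply_symm_apply _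
    linear_combination σ * h1 + (y - g (e.symm (σ * y))) * hσ
  have hp : Function.Periodic (fun y : ℝ => ((e.symm (σ * y) : ℝ) : AddCircle L)) L := by
    intro y
    dsimp only
    rcases h.sign with rfl | rfl
    · have h1 : e.symm (1 * (y + L)) = e.symm (1 * y) + L := by
        rw [Homeomorph.symm_apply_eq, he, h.add_period, hr]
        ring
      rw [h1]
      simp
    · have h1 : e.symm (-1 * (y + L)) = e.symm (-1 * y) - L := by
        rw [Homeomorph.symm_apply_eq, he]
        have h2 := h.add_period (e.symm (-1 * y) - L)
        rw [sub_add_cancel, hr] at h2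
        linear_combination -h2
      rw [h1]
      simp
  refine ⟨⟨g, h.contDiff, h.coe_apply⟩, hp.lift,
    ⟨fun y => e.symm (σ * y), hes.comp (contDiff_const.mul contDiff_id), fun y => hp.lift_coe y⟩,
    fun p => ?_, fun p => ?_⟩
  · induction p using QuotientAddGroup.induction_on with | _ x =>
    change hp.lift (η (x : AddCircle L)) = (x : AddCircle L)
    rw [h.coe_apply, hp.lift_coe, hl]
  · induction p using QuotientAddGroup.induction_on with | _ x =>
    rw [hp.lift_coe, h.coe_apply, hr]

theorem jac_eq (hL : 0 < L) (h : IsLift η σ g) (x : ℝ) :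
    jac η (x : AddCircle L) = σ * deriv g x := by
  rw [jac_eq_abs_deriv hL h.contDiff h.coe_apply, ← abs_of_pos (h.deriv_pos x), abs_mul]
  rcases h.sign with rfl | rfl <;> simp

theorem jac_pos (hL : 0 < L) (h : IsLift η σ g) (p : AddCircle L) : 0 < jac η p := by
  induction p using QuotientAddGroup.induction_on with | _ x =>
  rw [h.jac_eq hL]
  exact h.deriv_pos x

theorem contDiff_jac (hL : 0 < L) (h : IsLift η σ g) :
    ContDiff ℝ ∞ (fun x : ℝ => jac η (x : AddCircle L)) := by
  simp only [h.jac_eq hL]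
  exact contDiff_const.mul ((contDiff_infty_iff_deriv).1 h.contDiff).2

theorem ofFun_jac (hL : 0 < L) (h : IsLift η σ g) (p : AddCircle L) :
    (ofFun (jac η)).1 p = jac η p := ofFun_apply (h.contDiff_jac hL) p

/-- On the compact circle the Jacobian is bounded away from zero and `D U` is bounded, so a small
displacement preserves the sign of the derivative. -/
theorem eventually [Fact (0 < L)] (h : IsLift η σ g) (U : SmoothFun L) :
    ∀ᶠ t : ℝ in 𝓝 0, IsLift (fun p => η p + (((t • U).1 p : ℝ) : AddCircle L)) σ
      (fun x => g x + t * U.1 (x : AddCircle L)) := by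
  have hL : 0 < L := Fact.out
  obtain ⟨δ, hδ, hδ'⟩ := exists_pos_le (f := ofFun (jac η)) fun p => by
    rw [h.ofFun_jac hL]; exact h.jac_pos hL p
  obtain ⟨C, hC⟩ := isCompact_univ.exists_bound_of_continuousOn
    (SmoothFun.continuous (D U)).continuousOn
  have hsmall : ∀ᶠ t : ℝ in 𝓝 0, |t| * (|C| + 1) < δ := by
    have : Tendsto (fun t : ℝ => |t| * (|C| + 1)) (𝓝 0) (𝓝 (|0| * (|C| + 1))) :=
      (continuous_abs.mul continuous_const).tendsto 0
    exact this.eventually (gt_mem_nhds (by simpa using hδ))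
  filter_upwards [hsmall] with t ht
  have hder (x : ℝ) : deriv (fun x => g x + t * U.1 (x : AddCircle L)) x
      = deriv g x + t * (D U).1 (x : AddCircle L) :=
    ((h.contDiff.differentiable (by simp) x).hasDerivAt.add
      ((SmoothFun.hasDerivAt U x).const_mul t)).deriv
  refine ⟨h.contDiff.add (contDiff_const.mul (SmoothFun.contDiff U)), fun x => ?_, h.sign,
    fun x => ?_, fun x => ?_⟩
  · simp [h.coe_apply x]
  · have h1 := hδ' (x : AddCircle L)
    rw [h.ofFun_jac hL, h.jac_eq hL] at h1
    have h2 := hC (x : AddCircle L) (mem_univ _)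
    have h3 : |σ * (t * (D U).1 (x : AddCircle L))| ≤ |t| * (|C| + 1) := by
      have hσ : |σ| = 1 := by rcases h.sign with rfl | rfl <;> simp
      rw [abs_mul, abs_mul, hσ, one_mul]
      exact mul_le_mul_of_nonneg_left ((h2.trans (le_abs_self C)).trans (by linarith))
        (abs_nonneg t)
    rw [hder, mul_add]
    linarith [neg_abs_le (σ * (t * (D U).1 (x : AddCircle L)))]
  · rw [h.add_period, AddCircle.coe_add_period]
    ring

theorem jac_add [Fact (0 < L)] {t : ℝ} {U : SmoothFun L} (h : IsLift η σ g)
    (h' : IsLift (fun p => η p + (((t • U).1 p : ℝ) : AddCircle L)) σ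
      (fun x => g x + t * U.1 (x : AddCircle L))) :
    ofFun (jac (fun p => η p + (((t • U).1 p : ℝ) : AddCircle L)))
      = ofFun (jac η) + t • (σ • D U) := by
  have hL : 0 < L := Fact.out
  ext p
  induction p using QuotientAddGroup.induction_on with | _ x =>
  have hder : deriv (fun x => g x + t * U.1 (x : AddCircle L)) x
      = deriv g x + t * (D U).1 (x : AddCircle L) :=
    ((h.contDiff.differentiable (by simp) x).hasDerivAt.add
      ((SmoothFun.hasDerivAt U x).const_mul t)).deriv
  rw [h'.ofFun_jac hL]
  change jac _ (x : AddCircle L) = _ + t * (σ * (D U).1 (x : AddCircle L))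
  rw [h'.jac_eq hL, hder]
  rw [h.ofFun_jac hL, h.jac_eq hL]
  ring

/-- Change of variables; for `σ = -1` the sign in the Jacobian offsets the reversed limits. -/
theorem integral_comp_mul_jac [Fact (0 < L)] (h : IsLift η σ g) {f : AddCircle L → ℝ}
    (hf : Continuous f) : ∫ p, f (η p) * jac η p = ∫ q, f q := by
  have hL : 0 < L := Fact.out
  have hg' : Continuous (deriv g) := h.contDiff.continuous_deriv (by simp)
  have h1 : ∫ x in (0 : ℝ)..L, f (g x : AddCircle L) * deriv g x
      = ∫ y in g 0..g L, f (y : AddCircle L) :=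
    intervalIntegral.integral_comp_mul_deriv (g := fun y : ℝ => f (y : AddCircle L))
      (fun x _ => (h.contDiff.differentiable (by simp) x).hasDerivAt) hg'.continuousOn
      (hf.comp (AddCircle.continuous_mk' L))
  have h2 : ∫ p, f (η p) * jac η p
      = σ * ∫ x in (0 : ℝ)..L, f (g x : AddCircle L) * deriv g x := by
    rw [← AddCircle.intervalIntegral_preimage L 0, zero_add, ← intervalIntegral.integral_const_mul]
    refine intervalIntegral.integral_congr fun x _ => ?_
    rw [h.coe_apply, h.jac_eq hL]
    ring
  have h3 := h.add_period 0
  rw [zero_add] at h3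
  rw [h2, h1, h3]
  rcases h.sign with rfl | rfl
  · rw [one_mul, one_mul, AddCircle.intervalIntegral_preimage]
  · rw [intervalIntegral.integral_symm, ← AddCircle.intervalIntegral_preimage L (g 0 + -1 * L) f]
    simp

end IsLift

/-! ### The metric in Lagrangian coordinates -/

theorem contDiffOn_inv_Ioi : ContDiffOn ℝ ∞ (fun x : ℝ => x⁻¹) (Ioi 0) :=
  contDiffOn_id.inv fun _ hx => (ne_of_gt hx)

/-- The density `m / J` at the particles. -/
noncomputable def rho (m J : SmoothFun L) : SmoothFun L := m * comp (fun x => x⁻¹) J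

/-- The weight `J λ(m / J)`. -/
noncomputable def kappa (m : SmoothFun L) (lam : ℝ → ℝ) (J : SmoothFun L) : SmoothFun L :=
  J * comp lam (rho m J)

section Lagrangian

variable {m J : SmoothFun L} {lam : ℝ → ℝ}

theorem rho_apply (hJ : ∀ p, 0 < J.1 p) (p : AddCircle L) : (rho m J).1 p = m.1 p / J.1 p := by
  rw [rho, coe_mul, comp_apply contDiffOn_inv_Ioi hJ, div_eq_mul_inv]

theorem rho_pos (hm : ∀ p, 0 < m.1 p) (hJ : ∀ p, 0 < J.1 p) (p : AddCircle L) :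
    0 < (rho m J).1 p := by
  rw [rho_apply hJ]
  exact div_pos (hm p) (hJ p)

theorem kappa_apply (hm : ∀ p, 0 < m.1 p) (hlam : ContDiffOn ℝ ∞ lam (Ioi 0))
    (hJ : ∀ p, 0 < J.1 p) (p : AddCircle L) :
    (kappa m lam J).1 p = J.1 p * lam ((rho m J).1 p) := by
  rw [kappa, coe_mul, comp_apply hlam (rho_pos hm hJ)]

theorem metric_eq [Fact (0 < L)] (hm : ∀ p, 0 < m.1 p) (hlam : ContDiffOn ℝ ∞ lam (Ioi 0))
    {c : Config L} {σ : ℝ} {g : ℝ → ℝ} (h : IsLift c.η σ g) (X Y : Tangent L) :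
    metric m lam c X Y
      = integral (kappa m lam (ofFun (jac c.η)) * X.2 * Y.2 + m * X.1 * Y.1) := by
  have hL : 0 < L := Fact.out
  obtain ⟨-, ζ, hζ, hl, hr⟩ := h.isDiffeo hL
  have hinv : Function.invFun c.η = ζ := by
    funext q
    apply hl.injective
    rw [hr q, Function.invFun_eq ⟨ζ q, hr q⟩]
  have hJ (p) : 0 < (ofFun (jac c.η)).1 p := by
    rw [h.ofFun_jac hL]; exact h.jac_pos hL p
  set J := ofFun (jac c.η)
  set E : SmoothFun L := comp lam (rho m J) * (X.2 * Y.2) + rho m J * (X.1 * Y.1) with hE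
  have h1 : metric m lam c X Y = ∫ q, E.1 (ζ q) := by
    unfold metric density
    rw [hinv]
    congr 1
    funext q
    rw [hE]
    simp only [coe_add, coe_mul]
    rw [comp_apply hlam (rho_pos hm hJ), rho_apply hJ, h.ofFun_jac hL]
  rw [h1, ← h.integral_comp_mul_jac (f := fun q => E.1 (ζ q))
    ((SmoothFun.continuous E).comp hζ.continuous), integral_apply]
  congr 1
  funext p
  rw [hl p, ← h.ofFun_jac hL p, hE]
  simp only [coe_add, coe_mul, kappa_apply hm hlam hJ, comp_apply hlam (rho_pos hm hJ)]
  have := rho_apply (m := m) hJ p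
  have h3 : m.1 p = (rho m J).1 p * J.1 p := by
    rw [this, div_mul_cancel₀ _ (hJ p).ne']
  rw [h3]
  ring

end Lagrangian

/-! ### The connection and its curvature as differential-algebraic expressions -/

/-- The Christoffel map
`(X, Y) ↦ (m⁻¹ D(P X₂ Y₂), κ⁻¹ P (DX₁ Y₂ + DY₁ X₂))`, where `im = m⁻¹` and `ik = κ⁻¹`. -/
noncomputable def christoffel (P im ik : SmoothFun L) :
    Tangent L →ₗ[ℝ] Tangent L →ₗ[ℝ] Tangent L :=
  LinearMap.mk₂ ℝ
    (fun X Y => (im * D (P * X.2 * Y.2), ik * (P * (D X.1 * Y.2 + D Y.1 * X.2))))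
    (fun X X' Y => by
      refine Prod.ext ?_ ?_ <;>
        simp only [Prod.fst_add, Prod.snd_add, map_add, mul_add, add_mul]
      abel)
    (fun a X Y => by
      refine Prod.ext ?_ ?_ <;>
        simp only [Prod.smul_fst, Prod.smul_snd, map_smul, mul_smul_comm, smul_mul_assoc, smul_add,
          mul_add])
    (fun X Y Y' => by
      refine Prod.ext ?_ ?_ <;>
        simp only [Prod.fst_add, Prod.snd_add, map_add, mul_add, add_mul]
      abel)
    (fun a X Y => by
      refine Prod.ext ?_ ?_ <;>
        simp only [Prod.smul_fst, Prod.smul_snd, map_smul, mul_smul_comm, smul_mul_assoc, smul_add,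
          mul_add])

theorem christoffel_apply (P im ik : SmoothFun L) (X Y : Tangent L) :
    christoffel P im ik X Y
      = (im * D (P * X.2 * Y.2), ik * (P * (D X.1 * Y.2 + D Y.1 * X.2))) := rfl

theorem christoffel_comm (P im ik : SmoothFun L) (X Y : Tangent L) :
    christoffel P im ik X Y = christoffel P im ik Y X := by
  simp only [christoffel_apply, mul_right_comm P X.2 Y.2, add_comm (D X.1 * Y.2)]

/-- The derivative of `christoffel P im ik X Y` in the direction `Z`, when `P` and `κ` have the
derivatives `Q DZ₁` and `2 P DZ₁`. -/
noncomputable def christoffelDeriv (P Q im ik : SmoothFun L) (Z X Y : Tangent L) : Tangent L :=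
  (im * D (Q * D Z.1 * X.2 * Y.2),
    ik * ((Q * D Z.1 - ik * (P + P) * D Z.1 * P) * (D X.1 * Y.2 + D Y.1 * X.2)))

/-- Metric compatibility: the right side is the variation of the metric when `κ` has derivative `2 P
DZ₁`. -/
theorem integral_christoffel_add [Fact (0 < L)] {κ m P im ik : SmoothFun L} (him : im * m = 1)
    (hik : ik * κ = 1) (X Y Z : Tangent L) :
    integral (κ * (christoffel P im ik Z X).2 * Y.2 + m * (christoffel P im ik Z X).1 * Y.1)
        + integral (κ * X.2 * (christoffel P im ik Z Y).2
          + m * X.1 * (christoffel P im ik Z Y).1)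
      = integral ((P + P) * D Z.1 * X.2 * Y.2) := by
  have key : (κ * (christoffel P im ik Z X).2 * Y.2 + m * (christoffel P im ik Z X).1 * Y.1)
      + (κ * X.2 * (christoffel P im ik Z Y).2 + m * X.1 * (christoffel P im ik Z Y).1)
      = (P + P) * D Z.1 * X.2 * Y.2 + D (P * Z.2 * X.2 * Y.1 + P * Z.2 * Y.2 * X.1) := by
    simp only [christoffel_apply, map_add, D_mul (P * Z.2 * X.2), D_mul (P * Z.2 * Y.2)]
    linear_combination (P * (D Z.1 * X.2 + D X.1 * Z.2) * Y.2
      + P * (D Z.1 * Y.2 + D Y.1 * Z.2) * X.2) * hik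
      + (D (P * Z.2 * X.2) * Y.1 + D (P * Z.2 * Y.2) * X.1) * him
  rw [← map_add, key, map_add, integral_D, add_zero]

theorem integral_curvature [Fact (0 < L)] {κ m P Q im ik : SmoothFun L} (him : im * m = 1)
    (hik : ik * κ = 1) {X Y R : Tangent L}
    (hR : R = christoffelDeriv P Q im ik X Y Y - christoffelDeriv P Q im ik Y X Y
      + christoffel P im ik X (christoffel P im ik Y Y)
      - christoffel P im ik Y (christoffel P im ik X Y)) :
    integral (κ * R.2 * X.2 + m * R.1 * X.1)
      = integral ((P * P * ik - Q) * ((D X.1 * Y.2 - D Y.1 * X.2) * (D X.1 * Y.2 - D Y.1 * X.2))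
          + P * P * im * ((D X.2 * Y.2 - X.2 * D Y.2) * (D X.2 * Y.2 - X.2 * D Y.2))) := by
  obtain ⟨U, A⟩ := X
  obtain ⟨V, B⟩ := Y
  set S : SmoothFun L := Q * D U * B * B - Q * D V * A * B
    + P * A * (ik * (P * (D V * B + D V * B))) - P * B * (ik * (P * (D U * B + D V * A))) with hS
  set g₁ : SmoothFun L := im * D (P * B * B) with hg₁
  set g₂ : SmoothFun L := im * D (P * A * B) with hg₂
  have hR₁ : R.1 = im * D S := by
    rw [hR, hS]
    simp only [christoffel_apply, christoffelDeriv, map_add, map_sub, Prod.fst_add, Prod.fst_sub]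
    ring
  have hR₂ : R.2 = ik * ((Q * D U - ik * (P + P) * D U * P) * (D V * B + D V * B)
      - (Q * D V - ik * (P + P) * D V * P) * (D U * B + D V * A)
      + P * (D U * (ik * (P * (D V * B + D V * B))) + D g₁ * A)
      - P * (D V * (ik * (P * (D U * B + D V * A))) + D g₂ * B)) := by
    rw [hR]
    simp only [christoffel_apply, christoffelDeriv, Prod.snd_add, Prod.snd_sub, ← hg₁, ← hg₂]
    ring
  have key : κ * R.2 * A + m * R.1 * U
      = ((P * P * ik - Q) * ((D U * B - D V * A) * (D U * B - D V * A))
          + P * P * im * ((D A * B - A * D B) * (D A * B - A * D B)))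
        + D (S * U + P * A * A * g₁ - P * A * B * g₂) := by
    have h1 : D (S * U + P * A * A * g₁ - P * A * B * g₂)
        = D S * U + S * D U + ((D P * A + P * D A) * A + P * A * D A) * (im *
            ((D P * B + P * D B) * B + P * B * D B)) + P * A * A * D g₁
          - ((D P * A + P * D A) * B + P * A * D B) * (im *
            ((D P * A + P * D A) * B + P * A * D B)) - P * A * B * D g₂ := by
      rw [map_sub, map_add, D_mul S, D_mul (P * A * A), D_mul (P * A * B), hg₁, hg₂]
      simp only [D_mul P, D_mul (P * _)]
      ring
    rw [h1, hR₁, hR₂]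
    -- These derivatives cancel between the two sides, so they remain atoms and no second derivative
    -- is expanded.
    generalize D g₁ = dg₁
    generalize D g₂ = dg₂
    generalize D S = dS
    rw [hS]
    linear_combination (dS * U) * him + (((Q * D U - ik * (P + P) * D U * P) * (D V * B + D V * B)
      - (Q * D V - ik * (P + P) * D V * P) * (D U * B + D V * A)
      + P * (D U * (ik * (P * (D V * B + D V * B))) + dg₁ * A)
      - P * (D V * (ik * (P * (D U * B + D V * A))) + dg₂ * B)) * A) * hik
  rw [key, map_add, integral_D, add_zero]

/-- Nondegeneracy, obtained by testing against `X - Y`. -/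
theorem eq_of_integral_mul_eq [Fact (0 < L)] {κ m : SmoothFun L} (hκ : ∀ p, 0 < κ.1 p)
    (hm : ∀ p, 0 < m.1 p) {X Y : Tangent L}
    (h : ∀ Z : Tangent L, integral (κ * X.2 * Z.2 + m * X.1 * Z.1)
      = integral (κ * Y.2 * Z.2 + m * Y.1 * Z.1)) : X = Y := by
  have h1 := h (X - Y)
  rw [← sub_eq_zero, ← map_sub] at h1
  have h2 : κ * X.2 * (X - Y).2 + m * X.1 * (X - Y).1
      - (κ * Y.2 * (X - Y).2 + m * Y.1 * (X - Y).1)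
      = κ * ((X - Y).2 * (X - Y).2) + m * ((X - Y).1 * (X - Y).1) := by
    simp only [Prod.snd_sub, Prod.fst_sub]
    ring
  rw [h2] at h1
  have h3 (p) : 0 ≤ κ.1 p * ((X - Y).2.1 p * (X - Y).2.1 p) :=
    mul_nonneg (hκ p).le (mul_self_nonneg _)
  have h4 (p) : 0 ≤ m.1 p * ((X - Y).1.1 p * (X - Y).1.1 p) :=
    mul_nonneg (hm p).le (mul_self_nonneg _)
  have h5 := eq_zero_of_integral_eq_zero (fun p => add_nonneg (h3 p) (h4 p)) h1
  have h6 (p) : κ.1 p * ((X - Y).2.1 p * (X - Y).2.1 p)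
      + m.1 p * ((X - Y).1.1 p * (X - Y).1.1 p) = 0 := congrArg (fun f => f.1 p) h5
  rw [← sub_eq_zero]
  refine Prod.ext (SmoothFun.ext fun p => ?_) (SmoothFun.ext fun p => ?_)
  · have h7 := ((add_eq_zero_iff_of_nonneg (h3 p) (h4 p)).1 (h6 p)).2
    exact mul_self_eq_zero.1 ((mul_eq_zero.1 h7).resolve_left (hm p).ne')
  · have h7 := ((add_eq_zero_iff_of_nonneg (h3 p) (h4 p)).1 (h6 p)).1
    exact mul_self_eq_zero.1 ((mul_eq_zero.1 h7).resolve_left (hκ p).ne')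

/-! ### The coefficients of the metric along curves -/

theorem comp_inv_mul {f : SmoothFun L} (hf : ∀ p, 0 < f.1 p) : comp (fun x => x⁻¹) f * f = 1 := by
  ext p
  rw [coe_mul, comp_apply contDiffOn_inv_Ioi hf, coe_one, inv_mul_cancel₀ (hf p).ne']

theorem comp_deriv_inv {f : SmoothFun L} (hf : ∀ p, 0 < f.1 p) :
    comp (deriv fun x : ℝ => x⁻¹) f = -(comp (fun x => x⁻¹) f * comp (fun x => x⁻¹) f) := by
  ext p
  have h1 : ContDiffOn ℝ ∞ (deriv fun x : ℝ => x⁻¹) (Ioi 0) :=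
    ((contDiffOn_infty_iff_deriv_of_isOpen isOpen_Ioi).1 contDiffOn_inv_Ioi).2
  rw [coe_neg, coe_mul, comp_apply contDiffOn_inv_Ioi hf, comp_apply h1 hf, deriv_inv, pow_two,
    mul_inv]

theorem contDiffOn_deriv_Ioi {f : ℝ → ℝ} (hf : ContDiffOn ℝ ∞ f (Ioi 0)) :
    ContDiffOn ℝ ∞ (deriv f) (Ioi 0) :=
  ((contDiffOn_infty_iff_deriv_of_isOpen isOpen_Ioi).1 hf).2

theorem contDiffOn_phi {lam : ℝ → ℝ} (hlam : ContDiffOn ℝ ∞ lam (Ioi 0)) :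
    ContDiffOn ℝ ∞ (phi lam) (Ioi 0) :=
  (hlam.sub (contDiffOn_id.mul (contDiffOn_deriv_Ioi hlam))).div_const 2

/-- The function `σ φ(m / J)`. -/
noncomputable def signedPhi (m : SmoothFun L) (lam : ℝ → ℝ) (σ : ℝ) (J : SmoothFun L) :
    SmoothFun L :=
  σ • comp (phi lam) (rho m J)

/-- The derivative `-φ'(m / J) m / J²` of `φ(m / J)` with respect to `J`. -/
noncomputable def phiDeriv (m : SmoothFun L) (lam : ℝ → ℝ) (J : SmoothFun L) : SmoothFun L :=
  -(comp (deriv (phi lam)) (rho m J) * rho m J * comp (fun x => x⁻¹) J)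

/-- The Christoffel map of the metric at the diffeomorphisms with Jacobian `J` and sign `σ`. -/
noncomputable def leviCivita (m : SmoothFun L) (lam : ℝ → ℝ) (σ : ℝ) (J : SmoothFun L) :
    Tangent L →ₗ[ℝ] Tangent L →ₗ[ℝ] Tangent L :=
  christoffel (signedPhi m lam σ J) (comp (fun x => x⁻¹) m)
    (comp (fun x => x⁻¹) (kappa m lam J))

variable {m : SmoothFun L} {lam : ℝ → ℝ}

theorem kappa_pos (hm : ∀ p, 0 < m.1 p) (hlam : ContDiffOn ℝ ∞ lam (Ioi 0))
    (hpos : ∀ x, 0 < x → 0 < lam x) {J : SmoothFun L} (hJ : ∀ p, 0 < J.1 p) (p : AddCircle L) :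
    0 < (kappa m lam J).1 p := by
  rw [kappa_apply hm hlam hJ]
  exact mul_pos (hJ p) (hpos _ (rho_pos hm hJ p))

section Velocity

variable {W : ℝ → SmoothFun L} {V : SmoothFun L}

theorem hasVelocity_rho (hW : HasVelocity W V) (hpos : ∀ᶠ t in 𝓝 0, ∀ p, 0 < (W t).1 p) :
    HasVelocity (fun t => rho m (W t)) (-(rho m (W 0) * comp (fun x => x⁻¹) (W 0) * V)) := by
  have h := (hW.comp contDiffOn_inv_Ioi hpos).const_mul m
  rw [comp_deriv_inv hpos.self_of_nhds] at h
  refine h.congr_velocity ?_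
  rw [rho]
  ring

/-- The origin of `φ`: the `J`-derivative of `J λ(m / J)` is `λ(ρ) - ρ λ'(ρ) = 2 φ(ρ)`. -/
theorem hasVelocity_kappa (hm : ∀ p, 0 < m.1 p) (hlam : ContDiffOn ℝ ∞ lam (Ioi 0))
    (hW : HasVelocity W V) (hpos : ∀ᶠ t in 𝓝 0, ∀ p, 0 < (W t).1 p) :
    HasVelocity (fun t => kappa m lam (W t))
      ((comp (phi lam) (rho m (W 0))
        + comp (phi lam) (rho m (W 0))) * V) := by
  have h := hW.mul ((hasVelocity_rho (m := m) hW hpos).comp hlam (hpos.mono fun t ht => rho_pos hm ht))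
  refine h.congr_velocity ?_
  have h0 := hpos.self_of_nhds
  have hr := rho_pos hm h0
  ext p
  simp only [coe_mul, coe_add, coe_neg, comp_apply hlam hr, comp_apply (contDiffOn_phi hlam) hr,
    comp_apply (contDiffOn_deriv_Ioi hlam) hr, comp_apply contDiffOn_inv_Ioi h0, phi]
  have := (h0 p).ne'
  field_simp
  ring

theorem hasVelocity_comp_phi (hm : ∀ p, 0 < m.1 p) (hlam : ContDiffOn ℝ ∞ lam (Ioi 0))
    (hW : HasVelocity W V) (hpos : ∀ᶠ t in 𝓝 0, ∀ p, 0 < (W t).1 p) :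
    HasVelocity (fun t => comp (phi lam) (rho m (W t)))
      (phiDeriv m lam (W 0) * V) := by
  have h := (hasVelocity_rho (m := m) hW hpos).comp (contDiffOn_phi hlam)
    (hpos.mono fun t ht => rho_pos hm ht)
  refine h.congr_velocity ?_
  rw [phiDeriv]
  ring

/-- The sign in `P` and the sign in the velocity of `J` cancel, so `Q` does not see the orientation.
-/
theorem hasVelocity_signedPhi (hm : ∀ p, 0 < m.1 p) (hlam : ContDiffOn ℝ ∞ lam (Ioi 0))
    {σ : ℝ} (hσ : σ * σ = 1) {V : SmoothFun L}
    (hW : HasVelocity W (σ • V)) (hpos : ∀ᶠ t in 𝓝 0, ∀ p, 0 < (W t).1 p) :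
    HasVelocity (fun t => signedPhi m lam σ (W t)) (phiDeriv m lam (W 0) * V) := by
  have h := (hasVelocity_comp_phi hm hlam hW hpos).const_smul σ
  rwa [mul_smul_comm, smul_smul, hσ, one_smul] at h

theorem hasVelocity_kappa_of_sign (hm : ∀ p, 0 < m.1 p) (hlam : ContDiffOn ℝ ∞ lam (Ioi 0))
    {σ : ℝ} {V : SmoothFun L}
    (hW : HasVelocity W (σ • V)) (hpos : ∀ᶠ t in 𝓝 0, ∀ p, 0 < (W t).1 p) :
    HasVelocity (fun t => kappa m lam (W t))
      ((signedPhi m lam σ (W 0)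
        + signedPhi m lam σ (W 0)) * V) := by
  have h := hasVelocity_kappa hm hlam hW hpos
  rwa [mul_smul_comm, ← smul_mul_assoc, smul_add] at h

theorem hasVelocity_leviCivita (hm : ∀ p, 0 < m.1 p) (hlam : ContDiffOn ℝ ∞ lam (Ioi 0))
    (hlpos : ∀ x, 0 < x → 0 < lam x) {σ : ℝ} (hσ : σ * σ = 1) {Z : Tangent L}
    (hW : HasVelocity W (σ • D Z.1)) (hpos : ∀ᶠ t in 𝓝 0, ∀ p, 0 < (W t).1 p)
    (X Y : Tangent L) :
    HasVelocity (fun t => (leviCivita m lam σ (W t) X Y).1)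
        (christoffelDeriv (signedPhi m lam σ (W 0)) (phiDeriv m lam (W 0))
          (comp (fun x => x⁻¹) m)
          (comp (fun x => x⁻¹) (kappa m lam (W 0))) Z X Y).1 ∧
      HasVelocity (fun t => (leviCivita m lam σ (W t) X Y).2)
        (christoffelDeriv (signedPhi m lam σ (W 0)) (phiDeriv m lam (W 0))
          (comp (fun x => x⁻¹) m)
          (comp (fun x => x⁻¹) (kappa m lam (W 0))) Z X Y).2 := by
  have hP := hasVelocity_signedPhi hm hlam hσ hW hpos
  refine ⟨?_, ?_⟩
  · exact ((hP.mul_const X.2).mul_const Y.2).D.const_mul _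
  · have hk := (hasVelocity_kappa_of_sign hm hlam hW hpos).comp contDiffOn_inv_Ioi
      (hpos.mono fun t ht => kappa_pos hm hlam hlpos ht)
    have h := hk.mul (hP.mul_const (D X.1 * Y.2 + D Y.1 * X.2))
    rw [comp_deriv_inv (kappa_pos hm hlam hlpos hpos.self_of_nhds)] at h
    refine h.congr_velocity ?_
    rw [christoffelDeriv]
    ring

end Velocity

/-! ### The Levi-Civita connection -/

section LeviCivita

variable [Fact (0 < L)] {c : Config L} {σ : ℝ} {g : ℝ → ℝ}

theorem IsLift.ofFun_jac_pos {η : AddCircle L → AddCircle L} (h : IsLift η σ g)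
    (p : AddCircle L) : 0 < (ofFun (jac η)).1 p := by
  rw [h.ofFun_jac Fact.out]
  exact h.jac_pos Fact.out p

/-- The witness is affine in `t`; it agrees with the true Jacobian while the orientation persists,
that is, for small `t`. -/
theorem IsLift.hasVelocity_jac (h : IsLift c.η σ g) (Z : Tangent L) :
    ∃ W : ℝ → SmoothFun L, W 0 = ofFun (jac c.η) ∧ HasVelocity W (σ • D Z.1) ∧
      (∀ᶠ t in 𝓝 0, ∀ p, 0 < (W t).1 p) ∧
      ∀ᶠ t in 𝓝 0, ofFun (jac (c.exp (t • Z)).η) = W t ∧ ∃ g', IsLift (c.exp (t • Z)).η σ g' := by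
  refine ⟨fun t => ofFun (jac c.η) + t • (σ • D Z.1), by simp, ?_, ?_, ?_⟩
  · simpa using (HasVelocity.const (ofFun (jac c.η))).add (HasVelocity.smul_id (σ • D Z.1))
  · filter_upwards [h.eventually Z.1] with t ht p
    rw [← h.jac_add ht]
    exact ht.ofFun_jac_pos p
  · filter_upwards [h.eventually Z.1] with t ht
    exact ⟨h.jac_add ht, _, ht⟩

theorem hasDerivAt_metric (hm : ∀ p, 0 < m.1 p) (hlam : ContDiffOn ℝ ∞ lam (Ioi 0))
    (hlpos : ∀ x, 0 < x → 0 < lam x) (h : IsLift c.η σ g) (X Y Z : Tangent L) :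
    HasDerivAt (fun t : ℝ => metric m lam (c.exp (t • Z)) X Y)
      (metric m lam c (leviCivita m lam σ (ofFun (jac c.η)) Z X) Y
        + metric m lam c X (leviCivita m lam σ (ofFun (jac c.η)) Z Y)) 0 := by
  obtain ⟨W, hW0, hW, hpos, he⟩ := h.hasVelocity_jac Z
  rw [metric_eq hm hlam h, metric_eq hm hlam h, leviCivita,
    integral_christoffel_add (comp_inv_mul hm)
      (comp_inv_mul (kappa_pos hm hlam hlpos h.ofFun_jac_pos))]
  have h1 := ((((hasVelocity_kappa_of_sign hm hlam hW hpos).mul_const X.2).mul_const Y.2).add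
    (HasVelocity.const (m * X.1 * Y.1))).integral
  rw [add_zero, hW0] at h1
  refine h1.congr_of_eventuallyEq ?_
  filter_upwards [he] with t ht
  obtain ⟨hj, g', hg'⟩ := ht
  rw [metric_eq hm hlam hg', hj]

theorem IsLeviCivita.eq_leviCivita (hm : ∀ p, 0 < m.1 p) (hlam : ContDiffOn ℝ ∞ lam (Ioi 0))
    (hlpos : ∀ x, 0 < x → 0 < lam x) {Γ : Christoffel L} (hΓ : IsLeviCivita m lam Γ)
    (h : IsLift c.η σ g) : Γ c = leviCivita m lam σ (ofFun (jac c.η)) := by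
  obtain ⟨hs, hd⟩ := hΓ c (h.isDiffeo Fact.out)
  have hs' (X Y : Tangent L) : leviCivita m lam σ (ofFun (jac c.η)) X Y
      = leviCivita m lam σ (ofFun (jac c.η)) Y X := christoffel_comm _ _ _ X Y
  have hsymm (X Y : Tangent L) : metric m lam c X Y = metric m lam c Y X := by
    rw [metric_eq hm hlam h, metric_eq hm hlam h]
    congr 1
    ring
  have hu (X Y Z : Tangent L) := (hd X Y Z).unique (hasDerivAt_metric hm hlam hlpos h X Y Z)
  refine LinearMap.ext fun X => LinearMap.ext fun Y =>
    eq_of_integral_mul_eq (kappa_pos hm hlam hlpos h.ofFun_jac_pos) hm fun Z => ?_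
  rw [← metric_eq hm hlam h, ← metric_eq hm hlam h]
  -- Koszul's combination: the first two identities minus the third isolate `2 ⟪Γ(X, Y), Z⟫`.
  have h1 := hu Y Z X
  have h2 := hu X Z Y
  have h3 := hu X Y Z
  rw [hs Y X, hs' Y X] at h2
  rw [hs Z X, hs Z Y, hs' Z X, hs' Z Y] at h3
  linarith [hsymm Y (Γ c X Z), hsymm Y (leviCivita m lam σ (ofFun (jac c.η)) X Z)]

theorem exists_isLeviCivita (hm : ∀ p, 0 < m.1 p) (hlam : ContDiffOn ℝ ∞ lam (Ioi 0))
    (hlpos : ∀ x, 0 < x → 0 < lam x) : ∃ Γ : Christoffel L, IsLeviCivita m lam Γ := by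
  have h (c : Config L) : ∃ G : Tangent L →ₗ[ℝ] Tangent L →ₗ[ℝ] Tangent L, IsDiffeo c.η →
      (∀ X Y : Tangent L, G X Y = G Y X) ∧ ∀ X Y Z : Tangent L,
        HasDerivAt (fun t : ℝ => metric m lam (c.exp (t • Z)) X Y)
          (metric m lam c (G Z X) Y + metric m lam c X (G Z Y)) 0 := by
    by_cases hc : IsDiffeo c.η
    · obtain ⟨σ, g, hg⟩ := hc.exists_isLift Fact.out
      exact ⟨leviCivita m lam σ (ofFun (jac c.η)), fun _ => ⟨christoffel_comm _ _ _,
        hasDerivAt_metric hm hlam hlpos hg⟩⟩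
    · exact ⟨0, fun h => absurd h hc⟩
  choose Γ hΓ using h
  exact ⟨Γ, hΓ⟩

theorem IsLeviCivita.hasDirDeriv (hm : ∀ p, 0 < m.1 p) (hlam : ContDiffOn ℝ ∞ lam (Ioi 0))
    (hlpos : ∀ x, 0 < x → 0 < lam x) {Γ : Christoffel L} (hΓ : IsLeviCivita m lam Γ)
    (h : IsLift c.η σ g) (X Y Z : Tangent L) :
    HasDirDeriv (fun b => Γ b X Y) c Z
      (christoffelDeriv (signedPhi m lam σ (ofFun (jac c.η))) (phiDeriv m lam (ofFun (jac c.η)))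
        (comp (fun x => x⁻¹) m)
        (comp (fun x => x⁻¹) (kappa m lam (ofFun (jac c.η)))) Z X Y) := by
  obtain ⟨W, hW0, hW, hpos, he⟩ := h.hasVelocity_jac Z
  have h1 := hasVelocity_leviCivita hm hlam hlpos h.sign_mul_self hW hpos X Y
  rw [hW0] at h1
  have he' : ∀ᶠ t in 𝓝 (0 : ℝ), Γ (c.exp (t • Z)) X Y = leviCivita m lam σ (W t) X Y := by
    filter_upwards [he] with t ht
    obtain ⟨hj, g', hg'⟩ := ht
    rw [hΓ.eq_leviCivita hm hlam hlpos hg', hj]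
  exact ⟨h1.1.congr (he'.mono fun t ht => congrArg Prod.fst ht),
    h1.2.congr (he'.mono fun t ht => congrArg Prod.snd ht)⟩

theorem IsLeviCivita.exists_isCurvature_nonneg (hm : ∀ p, 0 < m.1 p)
    (hlam : ContDiffOn ℝ ∞ lam (Ioi 0)) (hlpos : ∀ x, 0 < x → 0 < lam x)
    (hcurv : CurvatureCondition lam) {Γ : Christoffel L} (hΓ : IsLeviCivita m lam Γ)
    (hc : IsDiffeo c.η) (X Y : Tangent L) :
    ∃ R : Tangent L, IsCurvature Γ c X Y Y R ∧ 0 ≤ metric m lam c R X := by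
  obtain ⟨σ, g, h⟩ := hc.exists_isLift Fact.out
  refine ⟨_, ⟨_, _, hΓ.hasDirDeriv hm hlam hlpos h Y Y X, hΓ.hasDirDeriv hm hlam hlpos h X Y Y,
    rfl⟩, ?_⟩
  have hJ := h.ofFun_jac_pos
  have hκ := kappa_pos hm hlam hlpos hJ
  have hr := rho_pos hm hJ
  rw [metric_eq hm hlam h, hΓ.eq_leviCivita hm hlam hlpos h, leviCivita,
    integral_curvature (comp_inv_mul hm) (comp_inv_mul hκ) rfl]
  refine SmoothFun.integral_nonneg fun p => ?_
  simp only [coe_add, coe_mul, coe_sub]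
  refine add_nonneg (mul_nonneg ?_ (mul_self_nonneg _)) (mul_nonneg (mul_nonneg
    (mul_self_nonneg _) ?_) (mul_self_nonneg _))
  -- The coefficient `P² / κ - Q` is the expression of the curvature condition at `ρ`, divided by
  -- `J`.
  · have h1 := div_nonneg (hcurv _ (hr p)) (hJ p).le
    convert h1 using 1
    simp only [signedPhi, phiDeriv, coe_neg, coe_mul, coe_smul, comp_apply contDiffOn_inv_Ioi hκ,
      comp_apply contDiffOn_inv_Ioi hJ, comp_apply (contDiffOn_phi hlam) hr,
      comp_apply (contDiffOn_deriv_Ioi (contDiffOn_phi hlam)) hr, kappa_apply hm hlam hJ]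
    have h2 := (hJ p).ne'
    have h3 := (hlpos _ (hr p)).ne'
    field_simp
    linear_combination phi lam ((rho m (ofFun (jac c.η))).1 p) ^ 2 * h.sign_mul_self
  · rw [comp_apply contDiffOn_inv_Ioi hm]
    exact inv_nonneg.2 (hm p).le

end LeviCivita

/-! ### Polytropic fluids -/

/-- For a polytropic pressure `A x ^ γ`, the function `x / λ(x)` is affine in `x ^ (γ - 1)`. -/
theorem exists_div_eq_of_pressure_eq {lam : ℝ → ℝ} {A γ : ℝ} (hlam : ContDiffOn ℝ ∞ lam (Ioi 0))
    (hpos : ∀ x, 0 < x → 0 < lam x) (hγ : 1 < γ)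
    (hp : ∀ x, 0 < x → pressure lam x = A * x ^ γ) :
    ∃ C, ∀ x, 0 < x → x / lam x = 2 * A / (γ - 1) * x ^ (γ - 1) + C := by
  -- `(x / λ)' = 2 φ / λ² = 2 p / x² = 2 A x^(γ-2)`.
  have hd (x : ℝ) (hx : 0 < x) :
      HasDerivAt (fun x => x / lam x - 2 * A / (γ - 1) * x ^ (γ - 1)) 0 x := by
    have h1 : HasDerivAt lam (deriv lam x) x :=
      ((hlam.differentiableOn (by simp)).differentiableAt (Ioi_mem_nhds hx)).hasDerivAt
    have h2 := ((hasDerivAt_id x).div h1 (hpos x hx).ne').sub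
      ((Real.hasDerivAt_rpow_const (p := γ - 1) (Or.inl hx.ne')).const_mul (2 * A / (γ - 1)))
    refine h2.congr_deriv ?_
    have h3 := hp x hx
    have h4 : x ^ γ = x ^ (γ - 1 - 1) * x ^ 2 := by
      rw [← Real.rpow_natCast x 2, ← Real.rpow_add hx]
      congr 1
      push_cast
      ring
    have h5 := (hpos x hx).ne'
    have h6 : γ - 1 ≠ 0 := (sub_pos.2 hγ).ne'
    rw [pressure, phi, h4] at h3
    field_simp at h3 ⊢
    simp only [id]
    linear_combination h3
  refine ⟨1 / lam 1 - 2 * A / (γ - 1) * 1 ^ (γ - 1), fun x hx => ?_⟩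
  have := isOpen_Ioi.is_const_of_deriv_eq_zero (s := Ioi (0 : ℝ)) isPreconnected_Ioi
    (fun x hx => (hd x hx).differentiableAt.differentiableWithinAt)
    (fun x hx => (hd x hx).deriv) (mem_Ioi.2 hx) (mem_Ioi.2 one_pos)
  linarith

/-- A negative slope fails for large `y`, a negative constant for small `y`. -/
theorem pos_and_nonneg_of_forall_affine_pos {a C : ℝ} (ha : a ≠ 0)
    (h : ∀ y, 0 < y → 0 < a * y + C) : 0 < a ∧ 0 ≤ C := by
  constructor
  · by_contra h0
    have h1 : a < 0 := lt_of_le_of_ne (not_lt.1 h0) ha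
    have h2 := h ((|C| + 1) / -a) (div_pos (by positivity) (by linarith))
    have h3 : a * ((|C| + 1) / -a) = -(|C| + 1) := by field_simp
    rw [h3] at h2
    linarith [le_abs_self C]
  · by_contra! h0
    have h1 : 0 < |a| := abs_pos.2 ha
    have h2 := h (-C / (2 * |a|)) (div_pos (by linarith) (by linarith))
    have h3 : a * (-C / (2 * |a|)) ≤ |a| * (-C / (2 * |a|)) :=
      mul_le_mul_of_nonneg_right (le_abs_self a) (div_pos (by linarith) (by linarith)).le
    have h4 : |a| * (-C / (2 * |a|)) = -C / 2 := by field_simp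
    linarith

/-- With `μ = a x^(γ-1) + C` one has `λ = x / μ` and `φ = A x^γ / μ²`; the rest is differentiation.
-/
theorem curvatureCondition_expr {lam : ℝ → ℝ} {A γ a C : ℝ} (hpos : ∀ x, 0 < x → 0 < lam x)
    (hp : ∀ x, 0 < x → pressure lam x = A * x ^ γ) (ha : a * (γ - 1) = 2 * A)
    (hC : ∀ x, 0 < x → x / lam x = a * x ^ (γ - 1) + C) {x : ℝ} (hx : 0 < x) :
    x * deriv (phi lam) x + phi lam x ^ 2 / lam x
      = A * x * x ^ (γ - 1) / (a * x ^ (γ - 1) + C) ^ 3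
        * (γ * (a * x ^ (γ - 1) + C) - 3 * A * x ^ (γ - 1)) := by
  have hphi (z : ℝ) (hz : 0 < z) : phi lam z = A * z ^ γ / (a * z ^ (γ - 1) + C) ^ 2 := by
    have h1 := hp z hz
    have h2 := (hpos z hz).ne'
    rw [← hC z hz, ← h1, pressure]
    field_simp
  have hμ : 0 < a * x ^ (γ - 1) + C := by
    rw [← hC x hx]
    exact div_pos hx (hpos x hx)
  have hlamx : lam x = x / (a * x ^ (γ - 1) + C) := by
    rw [← hC x hx, div_div_cancel₀ hx.ne']
  have hd := ((Real.hasDerivAt_rpow_const (p := γ) (Or.inl hx.ne')).const_mul A).div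
    ((((Real.hasDerivAt_rpow_const (p := γ - 1) (Or.inl hx.ne')).const_mul a).add_const C).pow 2)
    (pow_pos hμ 2).ne'
  have hd' := hd.congr_of_eventuallyEq (f₁ := phi lam)
    (by filter_upwards [Ioi_mem_nhds hx] with z hz using hphi z hz)
  have h1 : x ^ γ = x ^ (γ - 1) * x := by
    rw [Real.rpow_sub_one hx.ne', div_mul_cancel₀ _ hx.ne']
  have h2 : x ^ (γ - 1 - 1) = x ^ (γ - 1) / x := Real.rpow_sub_one hx.ne' _
  rw [hd'.deriv, hphi x hx, hlamx, h1, h2]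
  simp only [Pi.pow_apply, Nat.cast_ofNat, Nat.add_one_sub_one, pow_one]
  generalize x ^ (γ - 1) = y at hμ ⊢
  have h3 := hμ.ne'
  have h4 : a * ((γ - 1) * (y / x)) = 2 * A * (y / x) := by rw [← ha]; ring
  rw [h4]
  field_simp
  ring

theorem curvatureCondition_iff_of_pressure_eq {lam : ℝ → ℝ} {A γ : ℝ}
    (hlam : ContDiffOn ℝ ∞ lam (Ioi 0)) (hpos : ∀ x, 0 < x → 0 < lam x) (hA : A ≠ 0)
    (hγ : 1 < γ) (hp : ∀ x, 0 < x → pressure lam x = A * x ^ γ) :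
    CurvatureCondition lam ↔ γ ≤ 3 := by
  obtain ⟨C, hC⟩ := exists_div_eq_of_pressure_eq hlam hpos hγ hp
  have hγ' : 0 < γ - 1 := sub_pos.2 hγ
  set a : ℝ := 2 * A / (γ - 1) with ha
  have ha' : a * (γ - 1) = 2 * A := div_mul_cancel₀ _ hγ'.ne'
  have hsurj (y : ℝ) (hy : 0 < y) : ∃ x : ℝ, 0 < x ∧ x ^ (γ - 1) = y :=
    ⟨y ^ (γ - 1)⁻¹, Real.rpow_pos_of_pos hy _, Real.rpow_inv_rpow hy.le hγ'.ne'⟩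
  obtain ⟨hapos, hCnn⟩ := pos_and_nonneg_of_forall_affine_pos (a := a) (C := C)
    (div_ne_zero (mul_ne_zero two_ne_zero hA) hγ'.ne') fun y hy => by
      obtain ⟨x, hx, rfl⟩ := hsurj y hy
      rw [← hC x hx]
      exact div_pos hx (hpos x hx)
  have hApos : 0 < A := by linarith [mul_pos hapos hγ']
  have hiff : CurvatureCondition lam ↔ ∀ y, 0 < y → 0 ≤ γ * (a * y + C) - 3 * A * y := by
    have hsign (x : ℝ) (hx : 0 < x) :
        0 < A * x * x ^ (γ - 1) / (a * x ^ (γ - 1) + C) ^ 3 := by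
      have := Real.rpow_pos_of_pos hx (γ - 1)
      positivity
    refine ⟨fun h y hy => ?_, fun h x hx => ?_⟩
    · obtain ⟨x, hx, rfl⟩ := hsurj y hy
      have h1 := h x hx
      rw [curvatureCondition_expr hpos hp ha' hC hx] at h1
      exact nonneg_of_mul_nonneg_right h1 (hsign x hx)
    · rw [curvatureCondition_expr hpos hp ha' hC hx]
      exact mul_nonneg (hsign x hx).le (h _ (Real.rpow_pos_of_pos hx _))
  have hcoef : (γ * a - 3 * A) * 2 = a * (3 - γ) := by linear_combination 3 * ha'
  rw [hiff]
  refine ⟨fun h => ?_, fun h y hy => ?_⟩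
  · by_contra! h3
    have h4 : γ * a - 3 * A < 0 := by
      have := mul_pos hapos (sub_pos.2 h3)
      linarith
    -- At this point the affine function takes the value `-1`.
    have h5 := h ((γ * C + 1) / (3 * A - γ * a)) (div_pos (by positivity) (by linarith))
    have h6 : (3 * A - γ * a) * ((γ * C + 1) / (3 * A - γ * a)) = γ * C + 1 :=
      mul_div_cancel₀ _ (by linarith)
    linarith
  · have h4 : 0 ≤ (γ * a - 3 * A) * y :=
      mul_nonneg (by linarith [mul_nonneg hapos.le (sub_nonneg.2 h)]) hy.le
    have h5 : 0 ≤ γ * C := by positivity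
    linarith

end BarotropicCircle

theorem mainTheorem3 :
    (∀ (L : ℝ) [Fact (0 < L)] (m : BarotropicCircle.SmoothFun L) (lam : ℝ → ℝ),
      (∀ p : AddCircle L, 0 < m.1 p) →
      ContDiffOn ℝ ∞ lam (Set.Ioi 0) →
      (∀ x : ℝ, 0 < x → 0 < lam x) →
      (∃ Γ : BarotropicCircle.Christoffel L, BarotropicCircle.IsLeviCivita m lam Γ) ∧
      (BarotropicCircle.CurvatureCondition lam →
        ∀ Γ : BarotropicCircle.Christoffel L, BarotropicCircle.IsLeviCivita m lam Γ →
          ∀ c : BarotropicCircle.Config L, BarotropicCircle.IsDiffeo c.η →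
            ∀ X Y : BarotropicCircle.Tangent L, ∃ R : BarotropicCircle.Tangent L,
              BarotropicCircle.IsCurvature Γ c X Y Y R ∧
                0 ≤ BarotropicCircle.metric m lam c R X)) ∧
    (∀ (lam : ℝ → ℝ) (A γ : ℝ),
      ContDiffOn ℝ ∞ lam (Set.Ioi 0) →
      (∀ x : ℝ, 0 < x → 0 < lam x) →
      A ≠ 0 → 1 < γ →
      (∀ x : ℝ, 0 < x → BarotropicCircle.pressure lam x = A * x ^ γ) →
      (BarotropicCircle.CurvatureCondition lam ↔ γ ≤ 3)) :=
  ⟨fun _ _ _ _ hm hlam hpos =>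
      ⟨BarotropicCircle.exists_isLeviCivita hm hlam hpos, fun hcurv _ hΓ _ hc X Y =>
        hΓ.exists_isCurvature_nonneg hm hlam hpos hcurv hc X Y⟩,
    fun _ _ _ hlam hpos hA hγ hp =>
      BarotropicCircle.curvatureCondition_iff_of_pressure_eq hlam hpos hA hγ hp⟩
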